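/- Let $K$ be a field of characteristic $0$. By a graph we mean a finite connected multigraph (multiple edges and loops allowed) all of whose vertices have valence at least $3$. An orientation of a graph is a total order of its vertices together with a direction of each edge, up to an even number of transpositions of vertices and reversals of edges. Kontsevich's commutative graph complex $\mathcal G$ is the chain complex over $K$ whose degree $k$ term $\mathcal G_k$ is spanned by the isomorphism classes of oriented graphs with $k$ vertices, modulo the relations $(G,-\mathrm{or})=-(G,\mathrm{or})$, with boundary operator $\partial(G)=\sum_e G_e$, where the sum is over all edges $e$ of $G$ that are not loops and $G_e$ is obtained from $G$ by collapsing $e$ to a point. The orientation of $G_e$ is the induced one: if the orientation of $G$ is represented such that $e$ goes from the first to the second vertex, then the new vertex is the first vertex of $G_e$ and the order of the other vertices and the directions of the other edges are kept (a common sign for all graphs and edges is immaterial). A cut vertex of a graph is a vertex whose deletion disconnects the graph. Let $\mathcal C_k\subseteq\mathcal G_k$ be the subspace spanned by the graphs with at least one cut vertex; these subspaces form a subcomplex $\mathcal C$ of $\mathcal G$. **Theorem.** The complex $\mathcal C$ is acyclic, that is, $H_k(\mathcal C)=0$ for all $k$, and the quotient map of chain complexes $\mathcal G\to\mathcal G/\mathcal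 C$ induces an isomorphism on homology in every degree. -/

import Mathlib

noncomputable section

namespace CommGraphComplex

/-! ### Oriented graphs

An oriented graph with `k` vertices is a finite multigraph (loops and multiple edges allowed) with a
total order on its vertices, which are named `0, …, k - 1` in this order, and a direction on each of
its edges.  It is recorded as the multiset of its directed edges `(source, target)`.  Orientations
that differ by an even number of transpositions of vertices and reversals of edges are identified
below, in `GraphSpace`. -/

/-- A finite multigraph with ordered vertices `0, …, k - 1` and directed edges `(source, target)`. -/
abbrev OrGraph (k : ℕ) : Type := Multiset (Fin k × Fin k)

namespace OrGraph

variable {k l : ℕ}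

/-- Transport along a map of vertices. -/
def mapVertices (f : Fin k → Fin l) (M : OrGraph k) : OrGraph l :=
  Multiset.map (Prod.map f f) M

/-- The simple graph on the vertices in which two distinct vertices are adjacent
if they are joined by some edge. -/
def toSimple (M : OrGraph k) : SimpleGraph (Fin k) :=
  SimpleGraph.fromRel (fun a b => (a, b) ∈ M)

/-- The valence of a vertex: the number of half-edges at it (a loop counts twice). -/
def valence (M : OrGraph k) (v : Fin k) : ℕ :=
  Multiset.countP (fun e : Fin k × Fin k => e.1 = v) M +
    Multiset.countP (fun e : Fin k × Fin k => e.2 = v) M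

/-- The graphs that span the commutative graph complex: connected, with all valences at least `3`. -/
structure Admissible (M : OrGraph k) : Prop where
  connected : M.toSimple.Connected
  three_le_valence : ∀ v, 3 ≤ M.valence v

/-- A cut vertex is a vertex whose deletion disconnects the graph. -/
def IsCutVertex (M : OrGraph k) (v : Fin k) : Prop :=
  ¬ (M.toSimple.induce {v}ᶜ).Preconnected

/-- The map of vertices that sends the vertex `j` to `p`, all vertices before `j` to themselves, and
shifts the vertices after `j` down by one.  If `i = j.succAbove p`, it is the map that merges `i` and
`j` into one vertex, which takes the place of `i` when `j` is removed from the order. -/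
def merge (j : Fin (k + 1)) (p : Fin k) : Fin (k + 1) → Fin k :=
  Fin.insertNth (α := fun _ => Fin k) j p id

end OrGraph

open OrGraph

/-! ### The space of oriented graphs and its boundary operator -/

section Space

variable (K : Type*) [Field K] (k : ℕ)

/-- The orientation relations: a permutation of the vertices multiplies an oriented graph by the sign
of the permutation, and the reversal of an edge multiplies it by `-1`. -/
def orientationRelations : Submodule K (OrGraph k →₀ K) :=
  Submodule.span K
    ({r | ∃ (σ : Equiv.Perm (Fin k)) (M : OrGraph k),
        r = Finsupp.single (M.mapVertices σ) 1
          - ((Equiv.Perm.sign σ : ℤ) : K) • Finsupp.single M 1} ∪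
      {r | ∃ (a b : Fin k) (M : OrGraph k),
        r = Finsupp.single ((b, a) ::ₘ M) 1 + Finsupp.single ((a, b) ::ₘ M) 1})

/-- The vector space of all oriented graphs with `k` vertices modulo the orientation relations. -/
abbrev GraphSpace : Type _ := (OrGraph k →₀ K) ⧸ orientationRelations K k

variable {k}

/-- The class of an oriented graph. -/
def cls (M : OrGraph k) : GraphSpace K k :=
  Submodule.Quotient.mk (Finsupp.single M 1)

/-- The oriented graph obtained from `M` by collapsing the edge `e` of `M`, as an element of the
space of oriented graphs; loops are not collapsed and give `0`.  If `e` goes from `i` to `j ≠ i`, then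
`e` is deleted and `i` and `j` are merged.  The orientation of the result is the usual one: if the
vertices are reordered such that `e` goes from the first to the second vertex, the merged vertex
becomes the first one and the order of the others is kept (up to a global sign, which is the same for
all graphs and all edges, this is the sign `(-1) ^ j` for the order in which `j` is omitted and the
merged vertex takes the place of `i`). -/
def collapse (M : OrGraph (k + 1)) (e : Fin (k + 1) × Fin (k + 1)) : GraphSpace K k :=
  (finSuccEquiv' e.2 e.1).elim 0 fun p =>
    (-1 : K) ^ (e.2 : ℕ) • cls K (mapVertices (merge e.2 p) (M.erase e))

/-- The sum of all graphs obtained from `M` by collapsing one edge. -/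
def boundaryGraph (M : OrGraph (k + 1)) : GraphSpace K k :=
  (Multiset.map (collapse K M) M).sum

variable {K}

theorem cls_mapVertices (σ : Equiv.Perm (Fin k)) (M : OrGraph k) :
    cls K (M.mapVertices σ) = ((Equiv.Perm.sign σ : ℤ) : K) • cls K M := by
  have h : Finsupp.single (M.mapVertices σ) (1 : K)
      - ((Equiv.Perm.sign σ : ℤ) : K) • Finsupp.single M 1 ∈ orientationRelations K k :=
    Submodule.subset_span (Or.inl ⟨σ, M, rfl⟩)
  rw [← Submodule.Quotient.mk_eq_zero, Submodule.Quotient.mk_sub, sub_eq_zero,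
    Submodule.Quotient.mk_smul] at h
  exact h

theorem cls_flip (a b : Fin k) (M : OrGraph k) :
    cls K ((b, a) ::ₘ M) = - cls K ((a, b) ::ₘ M) := by
  have h : Finsupp.single ((b, a) ::ₘ M) (1 : K) + Finsupp.single ((a, b) ::ₘ M) 1
      ∈ orientationRelations K k :=
    Submodule.subset_span (Or.inr ⟨a, b, M, rfl⟩)
  rw [← Submodule.Quotient.mk_eq_zero, Submodule.Quotient.mk_add] at h
  exact eq_neg_of_add_eq_zero_left h

@[simp] theorem merge_same (j : Fin (k + 1)) (p : Fin k) : merge j p j = p := by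
  simp [merge]

@[simp] theorem merge_succAbove (j : Fin (k + 1)) (p q : Fin k) : merge j p (j.succAbove q) = q := by
  simp [merge]

theorem mapVertices_mapVertices {a b c : ℕ} (g : Fin b → Fin c) (f : Fin a → Fin b) (M : OrGraph a) :
    mapVertices g (mapVertices f M) = mapVertices (g ∘ f) M := by
  simp [mapVertices, Multiset.map_map, Prod.map]

theorem mapVertices_cons {a b : ℕ} (f : Fin a → Fin b) (x y : Fin a) (M : OrGraph a) :
    mapVertices f ((x, y) ::ₘ M) = (f x, f y) ::ₘ mapVertices f M := by
  simp [mapVertices]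

theorem collapse_loop (M : OrGraph (k + 1)) (j : Fin (k + 1)) : collapse K M (j, j) = 0 := by
  simp [collapse]

theorem collapse_edge (M : OrGraph (k + 1)) (j : Fin (k + 1)) (p : Fin k) :
    collapse K M (j.succAbove p, j) =
      (-1 : K) ^ (j : ℕ) • cls K (mapVertices (merge j p) (M.erase (j.succAbove p, j))) := by
  simp [collapse]

theorem edge_cases (e : Fin (k + 1) × Fin (k + 1)) :
    (∃ j, e = (j, j)) ∨ ∃ j p, e = (Fin.succAbove j p, j) := by
  obtain ⟨i, j⟩ := e
  by_cases h : i = j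
  · exact Or.inl ⟨j, by rw [h]⟩
  · obtain ⟨p, rfl⟩ := Fin.exists_succAbove_eq h
    exact Or.inr ⟨j, p, rfl⟩

/-- The permutation of the vertices other than `j` induced by a permutation of all vertices. -/
theorem exists_induced_perm (σ : Equiv.Perm (Fin (k + 1))) (j : Fin (k + 1)) :
    ∃ τ : Equiv.Perm (Fin k), (∀ p, σ (j.succAbove p) = (σ j).succAbove (τ p)) ∧
      (Equiv.Perm.sign σ : ℤ) * (-1) ^ ((σ j : Fin (k + 1)) : ℕ)
        = (-1) ^ (j : ℕ) * (Equiv.Perm.sign τ : ℤ) := by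
  set ρ : Equiv.Perm (Fin (k + 1)) := (Fin.cycleRange (σ j)) * σ * (Fin.cycleRange j)⁻¹ with hρ
  have hj : (Fin.cycleRange j)⁻¹ 0 = j := by
    rw [Equiv.Perm.inv_eq_iff_eq, Fin.cycleRange_self]
  have h0 : ρ 0 = 0 := by
    simp [hρ, Equiv.Perm.mul_apply, hj, Fin.cycleRange_self]
  obtain ⟨⟨x, τ⟩, hτ⟩ := Equiv.Perm.decomposeFin.symm.surjective ρ
  have hx : x = 0 := by
    rw [← hτ] at h0
    simpa using h0
  subst hx
  refine ⟨τ, fun p => ?_, ?_⟩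
  · apply (Fin.cycleRange (σ j)).injective
    rw [Fin.cycleRange_succAbove]
    have : ρ (Fin.succ p) = Fin.succ (τ p) := by
      rw [← hτ]; simp
    rw [← this, hρ, Equiv.Perm.mul_apply, Equiv.Perm.mul_apply]
    congr 2
    rw [eq_comm, Equiv.Perm.inv_eq_iff_eq, Fin.cycleRange_succAbove]
  · have hs : Equiv.Perm.sign ρ = Equiv.Perm.sign τ := by
      rw [← hτ]; simp
    rw [← hs, hρ]
    simp only [Equiv.Perm.sign_mul, Equiv.Perm.sign_inv, Fin.sign_cycleRange, Units.val_mul,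
      Units.val_pow_eq_pow_val, Units.val_neg, Units.val_one]
    have : ((-1 : ℤ) ^ (j : ℕ)) * (-1) ^ (j : ℕ) = 1 := by
      rw [← mul_pow]; simp
    linear_combination (-(Equiv.Perm.sign σ : ℤ) * (-1) ^ ((σ j : Fin (k + 1)) : ℕ)) * this

theorem merge_perm (σ : Equiv.Perm (Fin (k + 1))) (j : Fin (k + 1)) (τ : Equiv.Perm (Fin k))
    (hτ : ∀ p, σ (j.succAbove p) = (σ j).succAbove (τ p)) (p : Fin k) :
    merge (σ j) (τ p) ∘ σ = τ ∘ merge j p := by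
  funext v
  by_cases h : v = j
  · subst h; simp
  · obtain ⟨q, rfl⟩ := Fin.exists_succAbove_eq h
    simp [hτ]

theorem collapse_perm (σ : Equiv.Perm (Fin (k + 1))) (M : OrGraph (k + 1))
    (e : Fin (k + 1) × Fin (k + 1)) :
    collapse K (mapVertices σ M) (Prod.map σ σ e)
      = ((Equiv.Perm.sign σ : ℤ) : K) • collapse K M e := by
  rcases edge_cases e with ⟨j, rfl⟩ | ⟨j, p, rfl⟩
  · simp [collapse_loop]
  · obtain ⟨τ, hτ, hs⟩ := exists_induced_perm σ j
    have hinj : Function.Injective (Prod.map σ σ) := σ.injective.prodMap σ.injective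
    have herase : (mapVertices σ M).erase (Prod.map σ σ (j.succAbove p, j))
        = mapVertices σ (M.erase (j.succAbove p, j)) := by
      unfold mapVertices
      rw [Multiset.map_erase _ hinj]
    have he : Prod.map σ σ (j.succAbove p, j) = ((σ j).succAbove (τ p), σ j) := by
      simp [hτ]
    rw [he] at herase ⊢
    rw [collapse_edge, collapse_edge, herase, mapVertices_mapVertices, merge_perm σ j τ hτ,
      ← mapVertices_mapVertices, cls_mapVertices, smul_smul, smul_smul]
    congr 1
    have hs' := congrArg (fun z : ℤ => (z : K)) hs
    push_cast at hs'
    have hj : ((-1 : K) ^ (j : ℕ)) * (-1) ^ (j : ℕ) = 1 := by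
      rw [← mul_pow]; simp
    have hj' : ((-1 : K) ^ ((σ j : Fin (k + 1)) : ℕ)) * (-1) ^ ((σ j : Fin (k + 1)) : ℕ) = 1 := by
      rw [← mul_pow]; simp
    linear_combination (-(-1 : K) ^ ((σ j : Fin (k + 1)) : ℕ) * (-1) ^ (j : ℕ)) * hs'
      + ((((Equiv.Perm.sign σ : ℤ) : K)) * (-1) ^ (j : ℕ)) * hj'
      - ((-1 : K) ^ ((σ j : Fin (k + 1)) : ℕ) * ((Equiv.Perm.sign τ : ℤ) : K)) * hj

/-- Collapsing an edge and collapsing the reversed edge give opposite oriented graphs. -/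
theorem collapse_flip_head (a b : Fin (k + 1)) (M : OrGraph (k + 1)) :
    collapse K ((b, a) ::ₘ M) (b, a) = - collapse K ((a, b) ::ₘ M) (a, b) := by
  by_cases hab : a = b
  · subst hab; simp [collapse_loop]
  have h := collapse_perm (K := K) (Equiv.swap a b) ((a, b) ::ₘ M) (a, b)
  rw [Equiv.Perm.sign_swap hab] at h
  simp only [mapVertices_cons, Prod.map_apply, Equiv.swap_apply_left, Equiv.swap_apply_right] at h
  rw [show ((((-1 : ℤˣ) : ℤ)) : K) = -1 by simp, neg_one_smul] at h
  rw [← h]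
  obtain ⟨q, rfl⟩ := Fin.exists_succAbove_eq (Ne.symm hab)
  rw [collapse_edge, collapse_edge, Multiset.erase_cons_head, Multiset.erase_cons_head,
    mapVertices_mapVertices]
  congr 3
  funext v
  simp only [Function.comp_apply]
  by_cases h1 : v = a
  · subst h1; simp
  by_cases h2 : v = a.succAbove q
  · subst h2; simp
  · rw [Equiv.swap_apply_of_ne_of_ne h1 h2]

theorem collapse_flip_tail (a b : Fin (k + 1)) (M : OrGraph (k + 1))
    (e : Fin (k + 1) × Fin (k + 1)) (he : e ∈ M) :
    collapse K ((b, a) ::ₘ M) e = - collapse K ((a, b) ::ₘ M) e := by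
  rcases edge_cases e with ⟨j, rfl⟩ | ⟨j, p, rfl⟩
  · simp [collapse_loop]
  · rw [collapse_edge, collapse_edge, Multiset.erase_cons_tail_of_mem he,
      Multiset.erase_cons_tail_of_mem he, mapVertices_cons, mapVertices_cons, cls_flip, smul_neg]

theorem boundaryGraph_perm (σ : Equiv.Perm (Fin (k + 1))) (M : OrGraph (k + 1)) :
    boundaryGraph K (mapVertices σ M) = ((Equiv.Perm.sign σ : ℤ) : K) • boundaryGraph K M := by
  unfold boundaryGraph
  rw [Multiset.smul_sum, Multiset.map_map]
  have h : Multiset.map (collapse K (mapVertices σ M)) (mapVertices σ M)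
      = Multiset.map (collapse K (mapVertices σ M) ∘ Prod.map σ σ) M := by
    conv_lhs => rw [mapVertices, Multiset.map_map]
    rfl
  rw [h]
  congr 1
  exact Multiset.map_congr rfl fun e _ => collapse_perm (K := K) σ M e

theorem boundaryGraph_flip (a b : Fin (k + 1)) (M : OrGraph (k + 1)) :
    boundaryGraph K ((b, a) ::ₘ M) = - boundaryGraph K ((a, b) ::ₘ M) := by
  unfold boundaryGraph
  rw [Multiset.map_cons, Multiset.map_cons, Multiset.sum_cons, Multiset.sum_cons, neg_add,
    collapse_flip_head]
  congr 1
  rw [← Multiset.sum_map_neg', Multiset.map_map]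
  congr 1
  exact Multiset.map_congr rfl fun e he => collapse_flip_tail (K := K) a b M e he

variable (K k)

/-- The boundary operator `∂` on the space of oriented graphs: the boundary of an oriented graph is
the sum of all oriented graphs obtained from it by collapsing one edge (that is not a loop). -/
def boundary : GraphSpace K (k + 1) →ₗ[K] GraphSpace K k :=
  (orientationRelations K (k + 1)).liftQ
    (Finsupp.linearCombination K (boundaryGraph K (k := k))) (by
      refine Submodule.span_le.2 ?_
      rintro r (⟨σ, M, rfl⟩ | ⟨a, b, M, rfl⟩)
      · simp [boundaryGraph_perm]
      · rw [SetLike.mem_coe, LinearMap.mem_ker, map_add, Finsupp.linearCombination_single,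
          Finsupp.linearCombination_single, one_smul, one_smul, boundaryGraph_flip, neg_add_cancel])

variable {K k}

@[simp] theorem boundary_cls (M : OrGraph (k + 1)) :
    boundary K k (cls K M) = boundaryGraph K M := by
  change Finsupp.linearCombination K (boundaryGraph K (k := k)) (Finsupp.single M 1) = _
  simp

/-- Linear maps that agree on all classes of graphs are equal. -/
theorem linearMap_ext {V : Type*} [AddCommGroup V] [Module K V] {f g : GraphSpace K k →ₗ[K] V}
    (h : ∀ M : OrGraph k, f (cls K M) = g (cls K M)) : f = g := by
  apply Submodule.linearMap_qext
  apply Finsupp.lhom_ext'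
  intro M
  ext
  exact h M

/-- The contribution to `∂ (∂ M)` of an ordered pair of edges `e`, `f` with remaining edges `R`. -/
def collapsePair (e f : Fin (k + 2) × Fin (k + 2)) (R : OrGraph (k + 2)) : GraphSpace K k :=
  (finSuccEquiv' e.2 e.1).elim 0 fun p => (-1 : K) ^ (e.2 : ℕ) •
    collapse K (mapVertices (merge e.2 p) (f ::ₘ R)) (Prod.map (merge e.2 p) (merge e.2 p) f)

theorem collapsePair_edge (j : Fin (k + 2)) (p : Fin (k + 1)) (x y : Fin (k + 2))
    (R : OrGraph (k + 2)) : collapsePair (K := K) (j.succAbove p, j) (x, y) R = (-1 : K) ^ (j : ℕ) •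
      collapse K ((merge j p x, merge j p y) ::ₘ mapVertices (merge j p) R)
        (merge j p x, merge j p y) := by
  simp [collapsePair, mapVertices_cons]

theorem collapsePair_loop_left (j : Fin (k + 2)) (f : Fin (k + 2) × Fin (k + 2))
    (R : OrGraph (k + 2)) : collapsePair (K := K) (j, j) f R = 0 := by
  simp [collapsePair]

theorem collapsePair_loop_right (e : Fin (k + 2) × Fin (k + 2)) (j : Fin (k + 2))
    (R : OrGraph (k + 2)) : collapsePair (K := K) e (j, j) R = 0 := by
  rcases edge_cases e with ⟨i, rfl⟩ | ⟨i, p, rfl⟩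
  · exact collapsePair_loop_left _ _ _
  · rw [collapsePair_edge, collapse_loop, smul_zero]

theorem collapsePair_flip_right (e : Fin (k + 2) × Fin (k + 2)) (x y : Fin (k + 2))
    (R : OrGraph (k + 2)) :
    collapsePair (K := K) e (y, x) R = - collapsePair (K := K) e (x, y) R := by
  rcases edge_cases e with ⟨i, rfl⟩ | ⟨i, p, rfl⟩
  · simp [collapsePair_loop_left]
  · rw [collapsePair_edge, collapsePair_edge, collapse_flip_head, smul_neg]

theorem collapsePair_flip_left (a j : Fin (k + 2)) (f : Fin (k + 2) × Fin (k + 2))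
    (R : OrGraph (k + 2)) :
    collapsePair (K := K) (j, a) f R = - collapsePair (K := K) (a, j) f R := by
  by_cases haj : a = j
  · subst haj; simp [collapsePair_loop_left]
  obtain ⟨x, y⟩ := f
  obtain ⟨p, hp⟩ := Fin.exists_succAbove_eq haj
  obtain ⟨q, hq⟩ := Fin.exists_succAbove_eq (Ne.symm haj)
  obtain ⟨τ, hτ, hs⟩ := exists_induced_perm (Equiv.swap a j) j
  have hm := merge_perm (Equiv.swap a j) j τ hτ p
  have hτp := hτ p
  rw [Equiv.Perm.sign_swap haj, Equiv.swap_apply_right] at hs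
  rw [Equiv.swap_apply_right] at hm
  rw [hp, Equiv.swap_apply_left, Equiv.swap_apply_right, ← hq] at hτp
  have hqτ : q = τ p := Fin.succAbove_right_injective hτp
  have hm2 : merge a q = τ ∘ merge j p := by
    rw [← hm, ← hqτ]
    funext v
    simp only [Function.comp_apply]
    by_cases h1 : v = a
    · rw [h1, Equiv.swap_apply_left, merge_same]
      conv_rhs => rw [← hq]
      rw [merge_succAbove]
    by_cases h2 : v = j
    · rw [h2, Equiv.swap_apply_right, merge_same]
      conv_lhs => rw [← hq]
      rw [merge_succAbove]
    · rw [Equiv.swap_apply_of_ne_of_ne h1 h2]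
  have e1 : (j, a) = (a.succAbove q, a) := by rw [hq]
  have e2 : (a, j) = (j.succAbove p, j) := by rw [hp]
  rw [e1, e2, collapsePair_edge, collapsePair_edge, hm2, ← mapVertices_mapVertices]
  have h := collapse_perm (K := K) τ
    ((merge j p x, merge j p y) ::ₘ mapVertices (merge j p) R) (merge j p x, merge j p y)
  rw [mapVertices_cons] at h
  rw [Function.comp_apply, Function.comp_apply]
  rw [Prod.map_apply] at h
  rw [h, smul_smul, ← neg_smul]
  congr 1
  have hs' := congrArg (fun z : ℤ => (z : K)) hs
  push_cast at hs'
  have hj : ((-1 : K) ^ (j : ℕ)) * (-1) ^ (j : ℕ) = 1 := by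
    rw [← mul_pow]; simp
  have ha : ((-1 : K) ^ (a : ℕ)) * (-1) ^ (a : ℕ) = 1 := by
    rw [← mul_pow]; simp
  linear_combination (-(-1 : K) ^ (a : ℕ) * (-1) ^ (j : ℕ)) * hs'
      - ((-1 : K) ^ (j : ℕ)) * ha
      - ((-1 : K) ^ (a : ℕ) * ((Equiv.Perm.sign τ : ℤ) : K)) * hj

theorem collapsePair_comm_of_ne (i j a b : Fin (k + 2)) (hij : i ≠ j) (hab : a ≠ b) (hbj : b ≠ j)
    (R : OrGraph (k + 2)) :
    collapsePair (K := K) (i, j) (a, b) R = - collapsePair (K := K) (a, b) (i, j) R := by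
  obtain ⟨p, rfl⟩ := Fin.exists_succAbove_eq hij
  obtain ⟨p', rfl⟩ := Fin.exists_succAbove_eq hab
  obtain ⟨q, rfl⟩ := Fin.exists_succAbove_eq hbj
  set r : Fin (k + 1) := q.predAbove j with hr
  have hjr : (j.succAbove q).succAbove r = j := Fin.succAbove_succAbove_predAbove j q
  have hdbl : ∀ w : Fin k, (j.succAbove q).succAbove (r.succAbove w) = j.succAbove (q.succAbove w) :=
    fun w => Fin.succAbove_succAbove_succAbove_predAbove j q w
  have hsign : (-1 : K) ^ ((j.succAbove q : Fin (k + 2)) : ℕ) * (-1) ^ (r : ℕ)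
      = - ((-1) ^ (j : ℕ) * (-1) ^ (q : ℕ)) := by
    rw [← pow_add, ← pow_add]
    exact Fin.neg_one_pow_succAbove_add_predAbove j q
  rw [collapsePair_edge, collapsePair_edge, merge_succAbove]
  have hj2 : merge (j.succAbove q) p' j = r := by
    have h := merge_succAbove (j.succAbove q) p' r
    rwa [hjr] at h
  rw [hj2]
  by_cases hpq : p = q
  · subst hpq
    rw [merge_same]
    by_cases hp' : p' = r
    · rw [hp', hjr, merge_same, collapse_loop, collapse_loop, smul_zero, smul_zero, neg_zero]
    · obtain ⟨s, rfl⟩ := Fin.exists_succAbove_eq hp'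
      rw [hdbl, merge_succAbove, collapse_edge, collapse_edge, Multiset.erase_cons_head,
        Multiset.erase_cons_head, mapVertices_mapVertices, mapVertices_mapVertices, smul_smul,
        smul_smul, hsign, neg_smul, neg_neg]
      congr 3
      funext v
      simp only [Function.comp_apply]
      by_cases h1 : v = j
      · rw [h1, merge_same, merge_same, hj2, merge_same]
      · obtain ⟨w, rfl⟩ := Fin.exists_succAbove_eq h1
        rw [merge_succAbove]
        by_cases h2 : w = p
        · rw [h2, merge_same, merge_same, merge_succAbove]
        · obtain ⟨w, rfl⟩ := Fin.exists_succAbove_eq h2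
          rw [merge_succAbove, ← hdbl, merge_succAbove, merge_succAbove]
  · obtain ⟨t, rfl⟩ := Fin.exists_succAbove_eq hpq
    have h3 : merge (j.succAbove q) p' (j.succAbove (q.succAbove t)) = r.succAbove t := by
      rw [← hdbl, merge_succAbove]
    rw [h3]
    have key : ∀ s : Fin k, merge j (q.succAbove t) ((j.succAbove q).succAbove p') = q.succAbove s →
        merge r t p' = s →
        (-1 : K) ^ (j : ℕ) • collapse K ((merge j (q.succAbove t) ((j.succAbove q).succAbove p'), q)
            ::ₘ mapVertices (merge j (q.succAbove t)) R)
            (merge j (q.succAbove t) ((j.succAbove q).succAbove p'), q)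
          = -((-1 : K) ^ ((j.succAbove q : Fin (k + 2)) : ℕ) • collapse K ((r.succAbove t, r)
            ::ₘ mapVertices (merge (j.succAbove q) p') R) (r.succAbove t, r)) := by
      intro s hs hs'
      rw [hs, collapse_edge, collapse_edge, Multiset.erase_cons_head,
        Multiset.erase_cons_head, mapVertices_mapVertices, mapVertices_mapVertices, smul_smul,
        smul_smul, hsign, neg_smul, neg_neg]
      congr 3
      funext v
      simp only [Function.comp_apply]
      by_cases h1 : v = j
      · rw [h1, merge_same, hj2, merge_same, merge_succAbove]
      · obtain ⟨w, rfl⟩ := Fin.exists_succAbove_eq h1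
        rw [merge_succAbove]
        by_cases h2 : w = q
        · rw [h2, merge_same, merge_same, hs']
        · obtain ⟨w, rfl⟩ := Fin.exists_succAbove_eq h2
          rw [merge_succAbove, ← hdbl, merge_succAbove, merge_succAbove]
    by_cases hp' : p' = r
    · refine key t ?_ ?_
      · rw [hp', hjr, merge_same]
      · rw [hp', merge_same]
    · obtain ⟨s, rfl⟩ := Fin.exists_succAbove_eq hp'
      refine key s ?_ ?_
      · rw [hdbl, merge_succAbove]
      · rw [merge_succAbove]

theorem collapsePair_comm (e f : Fin (k + 2) × Fin (k + 2)) (R : OrGraph (k + 2)) :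
    collapsePair (K := K) e f R = - collapsePair (K := K) f e R := by
  obtain ⟨i, j⟩ := e
  obtain ⟨a, b⟩ := f
  by_cases hij : i = j
  · subst hij; rw [collapsePair_loop_left, collapsePair_loop_right, neg_zero]
  by_cases hab : a = b
  · subst hab; rw [collapsePair_loop_left, collapsePair_loop_right, neg_zero]
  by_cases hbj : b = j
  · subst hbj
    have h := collapsePair_comm_of_ne (K := K) i b b a hij (Ne.symm hab) hab R
    rw [collapsePair_flip_right _ a b, collapsePair_flip_left a b] at h
    exact neg_injective h
  · exact collapsePair_comm_of_ne i j a b hij hab hbj R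

theorem boundary_collapse (M : OrGraph (k + 2)) (e : Fin (k + 2) × Fin (k + 2)) :
    boundary K k (collapse K M e) =
      (Multiset.map (fun f => collapsePair e f ((M.erase e).erase f)) (M.erase e)).sum := by
  rcases edge_cases e with ⟨j, rfl⟩ | ⟨j, p, rfl⟩
  · simp [collapse_loop, collapsePair_loop_left]
  · rw [collapse_edge, map_smul, boundary_cls, boundaryGraph, Multiset.smul_sum, Multiset.map_map]
    conv_lhs => enter [1, 2]; rw [mapVertices]
    rw [Multiset.map_map]
    congr 1
    refine Multiset.map_congr rfl fun f hf => ?_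
    obtain ⟨x, y⟩ := f
    rw [collapsePair_edge]
    simp only [Function.comp_apply, Prod.map_apply]
    rw [← mapVertices_cons, Multiset.cons_erase hf]

theorem boundary_boundaryGraph (M : OrGraph (k + 2)) :
    boundary K k (boundaryGraph K M) = 0 := by
  obtain ⟨l, rfl⟩ : ∃ l : List (Fin (k + 2) × Fin (k + 2)), M = (l : Multiset _) :=
    ⟨M.toList, M.coe_toList.symm⟩
  have hM : ((l : Multiset (Fin (k + 2) × Fin (k + 2))))
      = Multiset.map l.get (Finset.univ : Finset (Fin l.length)).val := by
    rw [Fin.univ_val_map, List.ofFn_get]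
  generalize l.get = g at hM
  rw [hM]
  have hsum : boundary K k (boundaryGraph K (Multiset.map g Finset.univ.val)) =
      ∑ x ∈ (Finset.univ : Finset (Fin l.length)).sigma (fun a => Finset.univ.erase a),
        collapsePair (K := K) (g x.1) (g x.2)
          (Multiset.map g ((Finset.univ.erase x.1).erase x.2).val) := by
    rw [boundaryGraph, map_multiset_sum, Multiset.map_map, Multiset.map_map, Finset.sum_sigma]
    change ∑ a : Fin l.length, boundary K k (collapse K (Multiset.map g Finset.univ.val) (g a)) = _
    refine Finset.sum_congr rfl fun a _ => ?_
    rw [boundary_collapse, ← Multiset.map_erase_of_mem _ _ (Finset.mem_univ_val a),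
      ← Finset.erase_val, Multiset.map_map]
    refine congrArg Multiset.sum (Multiset.map_congr rfl fun b hb => ?_)
    rw [Function.comp_apply, ← Multiset.map_erase_of_mem _ _ hb, ← Finset.erase_val]
  rw [hsum]
  refine Finset.sum_involution (fun x _ => ⟨x.2, x.1⟩) ?_ ?_ ?_ ?_
  · rintro ⟨a, b⟩ _
    dsimp only
    rw [collapsePair_comm, Finset.erase_right_comm, neg_add_cancel]
  · rintro ⟨a, b⟩ h _ h'
    simp only [Finset.mem_sigma, Finset.mem_univ, Finset.mem_erase, true_and, and_true] at h
    simp only [Sigma.mk.injEq] at h'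
    exact h h'.1
  · rintro ⟨a, b⟩ h
    simp only [Finset.mem_sigma, Finset.mem_univ, Finset.mem_erase, true_and, and_true] at h ⊢
    exact Ne.symm h
  · intro x _
    rfl

theorem boundary_comp_boundary : boundary K k ∘ₗ boundary K (k + 1) = 0 := by
  refine linearMap_ext fun M => ?_
  rw [LinearMap.comp_apply, boundary_cls, boundary_boundaryGraph, LinearMap.zero_apply]

/-- A graph with a loop is zero: reversing the loop reverses the orientation. -/
theorem cls_eq_zero_of_loop [CharZero K] {M : OrGraph k} {a : Fin k} (h : (a, a) ∈ M) :
    cls K M = 0 := by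
  have h1 := cls_flip (K := K) a a (M.erase (a, a))
  rw [Multiset.cons_erase h] at h1
  have h2 : (2 : K) • cls K M = 0 := by
    rw [two_smul]
    nth_rewrite 1 [h1]
    exact neg_add_cancel _
  exact (smul_eq_zero.1 h2).resolve_left two_ne_zero

end Space

/-! ### Collapsing an edge preserves the class of graphs under consideration -/

section Collapse

variable {k : ℕ}

theorem toSimple_adj {M : OrGraph k} {a b : Fin k} :
    M.toSimple.Adj a b ↔ a ≠ b ∧ ((a, b) ∈ M ∨ (b, a) ∈ M) :=
  SimpleGraph.fromRel_adj _ _ _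

theorem mem_mapVertices {l : ℕ} {f : Fin k → Fin l} {M : OrGraph k} {x y : Fin k}
    (h : (x, y) ∈ M) : (f x, f y) ∈ mapVertices f M :=
  Multiset.mem_map_of_mem (Prod.map f f) h

theorem exists_of_mem_mapVertices {l : ℕ} {f : Fin k → Fin l} {M : OrGraph k} {x y : Fin l}
    (h : (x, y) ∈ mapVertices f M) : ∃ a b, (a, b) ∈ M ∧ f a = x ∧ f b = y := by
  obtain ⟨⟨a, b⟩, hab, he⟩ := Multiset.mem_map.1 h
  simp only [Prod.map_apply, Prod.mk.injEq] at he
  exact ⟨a, b, hab, he.1, he.2⟩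

theorem connected_collapse {M : OrGraph (k + 1)} (hM : M.toSimple.Connected) (j : Fin (k + 1))
    (p : Fin k) :
    (mapVertices (merge j p) (M.erase (j.succAbove p, j))).toSimple.Connected := by
  set N := mapVertices (merge j p) (M.erase (j.succAbove p, j)) with hN
  have hmem : ∀ x y, (x, y) ∈ M → merge j p x = merge j p y ∨ (merge j p x, merge j p y) ∈ N := by
    intro x y hxy
    by_cases h : (x, y) = (j.succAbove p, j)
    · left
      rw [Prod.mk.injEq] at h
      rw [h.1, h.2, merge_same, merge_succAbove]
    · exact Or.inr (mem_mapVertices ((Multiset.mem_erase_of_ne h).2 hxy))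
  have hadj : ∀ x y, M.toSimple.Adj x y → N.toSimple.Reachable (merge j p x) (merge j p y) := by
    intro x y hxy
    by_cases h : merge j p x = merge j p y
    · rw [h]
    · refine SimpleGraph.Adj.reachable (toSimple_adj.2 ⟨h, ?_⟩)
      rcases (toSimple_adj.1 hxy).2 with h1 | h1
      · exact Or.inl ((hmem _ _ h1).resolve_left h)
      · exact Or.inr ((hmem _ _ h1).resolve_left (Ne.symm h))
  have hreach : ∀ x y, M.toSimple.Reachable x y →
      N.toSimple.Reachable (merge j p x) (merge j p y) := by
    rintro x y ⟨w⟩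
    induction w with
    | nil => exact SimpleGraph.Reachable.refl _
    | cons h _ ih => exact (hadj _ _ h).trans ih
  have : Nonempty (Fin k) := ⟨p⟩
  refine SimpleGraph.Connected.mk fun x y => ?_
  have := hreach (j.succAbove x) (j.succAbove y) (hM.preconnected _ _)
  rwa [merge_succAbove, merge_succAbove] at this

theorem valence_cons (e : Fin k × Fin k) (M : OrGraph k) (v : Fin k) :
    valence (e ::ₘ M) v
      = valence M v + ((if e.1 = v then 1 else 0) + (if e.2 = v then 1 else 0)) := by
  unfold valence
  rw [Multiset.countP_cons, Multiset.countP_cons]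
  omega

theorem valence_merge (j : Fin (k + 1)) (p : Fin k) (M : OrGraph (k + 1)) (x : Fin k) :
    valence (mapVertices (merge j p) M) x
      = valence M (j.succAbove x) + if x = p then valence M j else 0 := by
  have hend : ∀ a : Fin (k + 1), (if merge j p a = x then 1 else 0 : ℕ)
      = (if a = j.succAbove x then 1 else 0) + if x = p then (if a = j then 1 else 0) else 0 := by
    intro a
    by_cases h : a = j
    · rw [h, merge_same]
      simp [Fin.ne_succAbove, eq_comm]
    · obtain ⟨b, rfl⟩ := Fin.exists_succAbove_eq h
      simp [Fin.succAbove_ne]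
  induction M using Multiset.induction_on with
  | empty => simp [mapVertices, valence]
  | cons e M ih =>
    obtain ⟨a, b⟩ := e
    rw [mapVertices_cons, valence_cons, valence_cons, valence_cons, ih]
    simp only [hend]
    split_ifs <;> omega

theorem admissible_collapse {M : OrGraph (k + 1)} (hM : Admissible M) {j : Fin (k + 1)} {p : Fin k}
    (he : (j.succAbove p, j) ∈ M) :
    Admissible (mapVertices (merge j p) (M.erase (j.succAbove p, j))) := by
  refine ⟨connected_collapse hM.connected j p, fun x => ?_⟩
  have hval : ∀ v, valence M v = valence (M.erase (j.succAbove p, j)) v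
      + ((if j.succAbove p = v then 1 else 0) + (if j = v then 1 else 0)) := by
    intro v
    conv_lhs => rw [← Multiset.cons_erase he]
    rw [valence_cons]
  have h1 := hM.three_le_valence (j.succAbove x)
  have h2 := hM.three_le_valence j
  rw [hval] at h1 h2
  rw [valence_merge]
  by_cases hx : x = p
  · subst hx
    simp only [if_true, Fin.succAbove_ne, Fin.ne_succAbove, if_false] at h1 h2 ⊢
    omega
  · have : ¬ (p = x) := fun h => hx h.symm
    simp only [Fin.succAbove_right_inj, Fin.ne_succAbove, if_false, hx, this] at h1 ⊢
    omega

/-- A vertex `v` is a cut vertex if and only if the other vertices can be divided into two nonempty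
parts such that no edge joins a vertex of one part to a vertex of the other part. -/
theorem isCutVertex_iff {M : OrGraph k} {v : Fin k} :
    M.IsCutVertex v ↔ ∃ S : Set (Fin k), (∃ a, a ∈ S ∧ a ≠ v) ∧ (∃ b, b ∉ S ∧ b ≠ v) ∧
      ∀ x y, (x, y) ∈ M → x ≠ v → y ≠ v → (x ∈ S ↔ y ∈ S) := by
  constructor
  · intro h
    unfold IsCutVertex SimpleGraph.Preconnected at h
    push Not at h
    obtain ⟨⟨a, ha⟩, ⟨b, hb⟩, hab⟩ := h
    refine ⟨{x | ∃ hx : x ∈ ({v}ᶜ : Set (Fin k)),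
      (M.toSimple.induce {v}ᶜ).Reachable ⟨a, ha⟩ ⟨x, hx⟩}, ⟨a, ⟨ha, SimpleGraph.Reachable.refl _⟩, ha⟩,
      ⟨b, fun ⟨_, h⟩ => hab h, hb⟩, ?_⟩
    intro x y hxy hx hy
    by_cases hne : x = y
    · rw [hne]
    have hadj : (M.toSimple.induce {v}ᶜ).Adj ⟨x, hx⟩ ⟨y, hy⟩ :=
      toSimple_adj.2 ⟨hne, Or.inl hxy⟩
    constructor
    · rintro ⟨_, h⟩
      exact ⟨hy, h.trans hadj.reachable⟩
    · rintro ⟨_, h⟩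
      exact ⟨hx, h.trans hadj.symm.reachable⟩
  · rintro ⟨S, ⟨a, haS, ha⟩, ⟨b, hbS, hb⟩, hS⟩ hpre
    have key : ∀ x y : ({v}ᶜ : Set (Fin k)), (M.toSimple.induce {v}ᶜ).Reachable x y →
        (x.1 ∈ S → y.1 ∈ S) := by
      rintro x y ⟨w⟩
      induction w with
      | nil => exact id
      | @cons x y z h _ ih =>
        intro hx
        refine ih ?_
        rcases (toSimple_adj.1 h).2 with h1 | h1
        · exact (hS _ _ h1 x.2 y.2).1 hx
        · exact (hS _ _ h1 y.2 x.2).2 hx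
    exact hbS (key ⟨a, ha⟩ ⟨b, hb⟩ (hpre _ _) haS)

theorem exists_edge_of_valence_pos {M : OrGraph k} {u : Fin k} (h : 0 < valence M u) :
    ∃ w, (u, w) ∈ M ∨ (w, u) ∈ M := by
  have : 0 < Multiset.countP (fun e : Fin k × Fin k => e.1 = u) M ∨
      0 < Multiset.countP (fun e : Fin k × Fin k => e.2 = u) M := by
    unfold valence at h
    omega
  rcases this with h | h
  · obtain ⟨⟨a, b⟩, hab, rfl⟩ := Multiset.countP_pos.1 h
    exact ⟨b, Or.inl hab⟩
  · obtain ⟨⟨a, b⟩, hab, rfl⟩ := Multiset.countP_pos.1 h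
    exact ⟨a, Or.inr hab⟩

/-- If collapsing an edge of a graph with a cut vertex does not create loops, the result still has a
cut vertex. -/
theorem exists_isCutVertex_collapse {M : OrGraph (k + 1)} (hM : Admissible M) {v : Fin (k + 1)}
    (hv : M.IsCutVertex v) {j : Fin (k + 1)} {p : Fin k} (he : (j.succAbove p, j) ∈ M)
    (hloop : ∀ a, (a, a) ∉ mapVertices (merge j p) (M.erase (j.succAbove p, j))) :
    ∃ w, (mapVertices (merge j p) (M.erase (j.succAbove p, j))).IsCutVertex w := by
  obtain ⟨S, ⟨a, haS, ha⟩, ⟨b, hbS, hb⟩, hS⟩ := isCutVertex_iff.1 hv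
  have herase : ∀ {e}, e ∈ M.erase (j.succAbove p, j) → e ∈ M := Multiset.mem_of_mem_erase
  by_cases hend : v = j ∨ v = j.succAbove p
  · -- the collapsed edge ends at the cut vertex; `u` is its other end
    obtain ⟨u, huv, hends, hval⟩ : ∃ u, u ≠ v ∧
        (∀ x : Fin (k + 1), merge j p x = p ↔ x = u ∨ x = v) ∧
        0 < valence (M.erase (j.succAbove p, j)) u := by
      have hm : ∀ x : Fin (k + 1), merge j p x = p ↔ x = j ∨ x = j.succAbove p := by
        intro x
        by_cases hx : x = j
        · simp [hx]
        · obtain ⟨q, rfl⟩ := Fin.exists_succAbove_eq hx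
          simp [Fin.succAbove_ne]
      have hpos : ∀ u, u = j ∨ u = j.succAbove p → 0 < valence (M.erase (j.succAbove p, j)) u := by
        intro u hu
        have h3 := hM.three_le_valence u
        rw [← Multiset.cons_erase he, valence_cons] at h3
        split_ifs at h3 <;> omega
      rcases hend with h | h
      · exact ⟨j.succAbove p, by rw [h]; exact Fin.succAbove_ne _ _,
          fun x => by rw [hm, h, or_comm], hpos _ (Or.inr rfl)⟩
      · exact ⟨j, by rw [h]; exact Fin.ne_succAbove _ _, fun x => by rw [hm, h],
          hpos _ (Or.inl rfl)⟩
    obtain ⟨w, hw⟩ := exists_edge_of_valence_pos hval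
    have hwp : merge j p w ≠ p := by
      intro h
      have hup : merge j p u = p := (hends u).2 (Or.inl rfl)
      rcases hw with hw | hw
      · have := mem_mapVertices (f := merge j p) hw
        rw [h, hup] at this
        exact hloop p this
      · have := mem_mapVertices (f := merge j p) hw
        rw [h, hup] at this
        exact hloop p this
    have hwuv : w ≠ u ∧ w ≠ v := by
      rw [Ne, hends] at hwp
      exact ⟨fun h => hwp (Or.inl h), fun h => hwp (Or.inr h)⟩
    have hlift : ∀ x, merge j p x ≠ p → j.succAbove (merge j p x) = x := by
      intro x hx
      by_cases h : x = j
      · rw [h, merge_same] at hx; exact absurd rfl hx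
      · obtain ⟨q, rfl⟩ := Fin.exists_succAbove_eq h
        rw [merge_succAbove]
    have hwS : w ∈ S ↔ u ∈ S := by
      rcases hw with hw | hw
      · exact (hS _ _ (herase hw) huv hwuv.2).symm
      · exact hS _ _ (herase hw) hwuv.2 huv
    -- there is a vertex other than `u` and `v` on either side
    obtain ⟨a', ha'S, ha'⟩ : ∃ a', a' ∈ S ∧ merge j p a' ≠ p := by
      by_cases hu : a = u
      · exact ⟨w, hwS.2 (hu ▸ haS), hwp⟩
      · exact ⟨a, haS, fun h => ((hends a).1 h).elim hu ha⟩
    obtain ⟨b', hb'S, hb'⟩ : ∃ b', b' ∉ S ∧ merge j p b' ≠ p := by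
      by_cases hu : b = u
      · exact ⟨w, fun h => hbS (hu ▸ hwS.1 h), hwp⟩
      · exact ⟨b, hbS, fun h => ((hends b).1 h).elim hu hb⟩
    refine ⟨p, isCutVertex_iff.2 ⟨{x | j.succAbove x ∈ S}, ⟨merge j p a', ?_, ha'⟩,
      ⟨merge j p b', ?_, hb'⟩, ?_⟩⟩
    · change j.succAbove (merge j p a') ∈ S; rw [hlift _ ha']; exact ha'S
    · change j.succAbove (merge j p b') ∉ S; rw [hlift _ hb']; exact hb'S
    · intro x y hxy hx hy
      obtain ⟨s, t, hst, rfl, rfl⟩ := exists_of_mem_mapVertices hxy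
      change j.succAbove (merge j p s) ∈ S ↔ j.succAbove (merge j p t) ∈ S
      rw [hlift _ hx, hlift _ hy]
      refine hS _ _ (herase hst) ?_ ?_
      · exact fun h => hx ((hends s).2 (Or.inr h))
      · exact fun h => hy ((hends t).2 (Or.inr h))
  · -- the collapsed edge does not end at the cut vertex
    push Not at hend
    have hij : j.succAbove p ∈ S ↔ j ∈ S := hS _ _ he (Ne.symm hend.2) (Ne.symm hend.1)
    have hmem : ∀ x, j.succAbove (merge j p x) ∈ S ↔ x ∈ S := by
      intro x
      by_cases h : x = j
      · rw [h, merge_same, hij]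
      · obtain ⟨q, rfl⟩ := Fin.exists_succAbove_eq h
        rw [merge_succAbove]
    have hne : ∀ x, x ≠ v → merge j p x ≠ merge j p v := by
      intro x hx h
      obtain ⟨q, hq⟩ := Fin.exists_succAbove_eq hend.1
      rw [← hq] at h hx hend
      rw [merge_succAbove] at h
      by_cases hxj : x = j
      · rw [hxj, merge_same] at h
        exact hend.2 (by rw [h])
      · obtain ⟨r, rfl⟩ := Fin.exists_succAbove_eq hxj
        rw [merge_succAbove] at h
        exact hx (by rw [h])
    refine ⟨merge j p v, isCutVertex_iff.2 ⟨{x | j.succAbove x ∈ S},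
      ⟨merge j p a, (hmem a).2 haS, hne a ha⟩, ⟨merge j p b, fun h => hbS ((hmem b).1 h), hne b hb⟩,
      ?_⟩⟩
    intro x y hxy hx hy
    obtain ⟨s, t, hst, rfl, rfl⟩ := exists_of_mem_mapVertices hxy
    change j.succAbove (merge j p s) ∈ S ↔ j.succAbove (merge j p t) ∈ S
    rw [hmem, hmem]
    exact hS _ _ (herase hst) (fun h => hx (by rw [h])) (fun h => hy (by rw [h]))

end Collapse

/-! ### The graph complex, the subcomplex of graphs with a cut vertex, and the quotient complex -/

section Complexes

universe u

variable (K : Type u) [Field K] (k : ℕ)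

/-- `𝒢ₖ`: the space spanned by all connected oriented graphs with `k` vertices of valence at least
`3`. -/
def graphSpan : Submodule K (GraphSpace K k) :=
  Submodule.span K {x | ∃ M : OrGraph k, Admissible M ∧ x = cls K M}

/-- `𝒞ₖ`: the space spanned by all connected oriented graphs with `k` vertices of valence at least `3`
at least one of which is a cut vertex. -/
def cutSpan : Submodule K (GraphSpace K k) :=
  Submodule.span K {x | ∃ M : OrGraph k, Admissible M ∧ (∃ v, M.IsCutVertex v) ∧ x = cls K M}

variable {K k}

theorem cutSpan_le_graphSpan : cutSpan K k ≤ graphSpan K k :=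
  Submodule.span_mono fun _ ⟨M, hM, _, hx⟩ => ⟨M, hM, hx⟩

theorem boundary_mem_graphSpan (x : GraphSpace K (k + 1)) (hx : x ∈ graphSpan K (k + 1)) :
    boundary K k x ∈ graphSpan K k := by
  suffices h : graphSpan K (k + 1) ≤ (graphSpan K k).comap (boundary K k) from h hx
  refine Submodule.span_le.2 ?_
  rintro _ ⟨M, hM, rfl⟩
  rw [SetLike.mem_coe, Submodule.mem_comap, boundary_cls]
  refine multiset_sum_mem _ fun y hy => ?_
  obtain ⟨e, he, rfl⟩ := Multiset.mem_map.1 hy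
  rcases edge_cases e with ⟨j, rfl⟩ | ⟨j, p, rfl⟩
  · rw [collapse_loop]; exact zero_mem _
  · rw [collapse_edge]
    exact Submodule.smul_mem _ _ (Submodule.subset_span ⟨_, admissible_collapse hM he, rfl⟩)

theorem boundary_mem_cutSpan [CharZero K] (x : GraphSpace K (k + 1)) (hx : x ∈ cutSpan K (k + 1)) :
    boundary K k x ∈ cutSpan K k := by
  suffices h : cutSpan K (k + 1) ≤ (cutSpan K k).comap (boundary K k) from h hx
  refine Submodule.span_le.2 ?_
  rintro _ ⟨M, hM, ⟨v, hv⟩, rfl⟩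
  rw [SetLike.mem_coe, Submodule.mem_comap, boundary_cls]
  refine multiset_sum_mem _ fun y hy => ?_
  obtain ⟨e, he, rfl⟩ := Multiset.mem_map.1 hy
  rcases edge_cases e with ⟨j, rfl⟩ | ⟨j, p, rfl⟩
  · rw [collapse_loop]; exact zero_mem _
  · rw [collapse_edge]
    refine Submodule.smul_mem _ _ ?_
    by_cases hloop : ∃ a, (a, a) ∈ mapVertices (merge j p) (M.erase (j.succAbove p, j))
    · obtain ⟨a, ha⟩ := hloop
      rw [cls_eq_zero_of_loop ha]
      exact zero_mem _
    · push Not at hloop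
      exact Submodule.subset_span
        ⟨_, admissible_collapse hM he, exists_isCutVertex_collapse hM hv he hloop, rfl⟩

theorem boundary_boundary (x : GraphSpace K (k + 2)) :
    boundary K k (boundary K (k + 1) x) = 0 :=
  LinearMap.congr_fun boundary_comp_boundary x

variable (K k)

/-- The boundary operator `∂ : 𝒢ₖ₊₁ → 𝒢ₖ`. -/
def graphBoundary : graphSpan K (k + 1) →ₗ[K] graphSpan K k :=
  (boundary K k).restrict boundary_mem_graphSpan

/-- The boundary operator `∂ : 𝒞ₖ₊₁ → 𝒞ₖ`. -/
def cutBoundary [CharZero K] : cutSpan K (k + 1) →ₗ[K] cutSpan K k :=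
  (boundary K k).restrict boundary_mem_cutSpan

/-- The boundary operator `∂ : 𝒢ₖ₊₁ / 𝒞ₖ₊₁ → 𝒢ₖ / 𝒞ₖ`. -/
def quotientBoundary [CharZero K] :
    (graphSpan K (k + 1) ⧸ (cutSpan K (k + 1)).submoduleOf (graphSpan K (k + 1))) →ₗ[K]
      (graphSpan K k ⧸ (cutSpan K k).submoduleOf (graphSpan K k)) :=
  Submodule.mapQ _ _ (graphBoundary K k) fun x hx => boundary_mem_cutSpan x.1 hx

theorem graphBoundary_comp : graphBoundary K k ∘ₗ graphBoundary K (k + 1) = 0 :=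
  LinearMap.ext fun x => Subtype.ext (boundary_boundary x.1)

theorem cutBoundary_comp [CharZero K] : cutBoundary K k ∘ₗ cutBoundary K (k + 1) = 0 :=
  LinearMap.ext fun x => Subtype.ext (boundary_boundary x.1)

theorem quotientBoundary_comp [CharZero K] :
    quotientBoundary K k ∘ₗ quotientBoundary K (k + 1) = 0 := by
  refine Submodule.linearMap_qext _ (LinearMap.ext fun x => ?_)
  change Submodule.Quotient.mk ((graphBoundary K k ∘ₗ graphBoundary K (k + 1)) x) = _
  rw [graphBoundary_comp]
  rfl

/-- The commutative graph complex `𝒢`, graded by the number of vertices. -/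
def graphComplex : ChainComplex (ModuleCat.{u} K) ℕ :=
  ChainComplex.of (fun k => ModuleCat.of K (graphSpan K k))
    (fun k => ModuleCat.ofHom (graphBoundary K k)) fun k =>
      ModuleCat.hom_ext (graphBoundary_comp K k)

/-- The subcomplex `𝒞` of `𝒢` spanned by the graphs with at least one cut vertex. -/
def cutComplex [CharZero K] : ChainComplex (ModuleCat.{u} K) ℕ :=
  ChainComplex.of (fun k => ModuleCat.of K (cutSpan K k))
    (fun k => ModuleCat.ofHom (cutBoundary K k)) fun k =>
      ModuleCat.hom_ext (cutBoundary_comp K k)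

/-- The quotient complex `𝒢 / 𝒞`. -/
def quotientComplex [CharZero K] : ChainComplex (ModuleCat.{u} K) ℕ :=
  ChainComplex.of
    (fun k => ModuleCat.of K (graphSpan K k ⧸ (cutSpan K k).submoduleOf (graphSpan K k)))
    (fun k => ModuleCat.ofHom (quotientBoundary K k)) fun k =>
      ModuleCat.hom_ext (quotientBoundary_comp K k)

theorem graphComplex_d :
    (graphComplex K).d (k + 1) k = ModuleCat.ofHom (graphBoundary K k) :=
  ChainComplex.of_d (fun k => ModuleCat.of K (graphSpan K k))
    (fun k => ModuleCat.ofHom (graphBoundary K k)) k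

theorem cutComplex_d [CharZero K] :
    (cutComplex K).d (k + 1) k = ModuleCat.ofHom (cutBoundary K k) :=
  ChainComplex.of_d (fun k => ModuleCat.of K (cutSpan K k))
    (fun k => ModuleCat.ofHom (cutBoundary K k)) k

theorem quotientComplex_d [CharZero K] :
    (quotientComplex K).d (k + 1) k = ModuleCat.ofHom (quotientBoundary K k) :=
  ChainComplex.of_d (fun k => ModuleCat.of K (graphSpan K k ⧸ (cutSpan K k).submoduleOf (graphSpan K k)))
    (fun k => ModuleCat.ofHom (quotientBoundary K k)) k

/-- The quotient map `𝒢 → 𝒢 / 𝒞`. -/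
def quotientMap [CharZero K] : graphComplex K ⟶ quotientComplex K :=
  ChainComplex.ofHom
    (fun k => ModuleCat.ofHom ((cutSpan K k).submoduleOf (graphSpan K k)).mkQ)
    (fun k => by
      rw [graphComplex_d, quotientComplex_d]
      rfl)

end Complexes

end CommGraphComplex

end

/-! The complex `𝒞` is contracted by an explicit operator up to terms that increase a finite
filtration. A lobe at a vertex `v` is a connected component `S` of the graph without `v` that is
joined to `v` by at least two edges, with other vertices left outside. Pulling `S` off `v` moves the
ends at `v` of these edges to a new vertex, joined to `v` by a new bridge. The operator `h` sends a
graph to the average of these pulls over all lobes, where a pull that would leave `v` with valence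
less than `3` counts as zero. A lobe exists in every loopless graph of `𝒞` (`exists_isLobe`), so
characteristic `0` allows the averaging; it also makes graphs with loops vanish.

The filtration counts the sets of vertices left by exactly one edge, in other words the bridges.
Pulling raises this number (`card_oneCuts_pull`) and collapsing an edge that is not a bridge does
not lower it (`card_oneCuts_contract`). Modulo higher filtration, only bridges and the newly created
edges therefore matter in `∂h + h∂`.

Collapsing a bridge induces a bijection of lobes (`lobes_contract`, `contractPair_injOn`), so the
averages before and after have the same denominator, and the terms can be compared lobe by lobe
(`collapsePullTerm_add`). If the lobe can be pulled off, pulling and collapsing commute and the two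
terms cancel by sign, while collapsing the new edge returns the graph `M`. If it cannot, exactly one
edge at `v`, the stem, leads away from the lobe. Collapsing the stem and then pulling off the lobe
returns `M` (`cls_pull_contract`), and other bridges contribute nothing. Each lobe thus accounts for
exactly one copy of `M`, and `∂h + h∂ - 1` raises the filtration (`boundary_homotopyGraph_add`).

A cycle can hence be changed by boundaries of elements of `𝒞` into arbitrarily high filtration. With
`k` vertices there are only `2 ^ k` sets, so the process ends at zero. The statement on the quotient
follows from the long exact homology sequence. -/

noncomputable section

namespace CommGraphComplex

open OrGraph

/-! ### Cuts of a graph -/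

namespace OrGraph

variable {k l : ℕ}

/-- The edge `e` has exactly one end in `A`. -/
def Crosses (A : Finset (Fin k)) (e : Fin k × Fin k) : Prop := ¬ (e.1 ∈ A ↔ e.2 ∈ A)

instance (A : Finset (Fin k)) : DecidablePred (Crosses A) := fun _ =>
  inferInstanceAs (Decidable (¬ _))

/-- The number of edges with exactly one end in `A`. -/
def cross (M : OrGraph k) (A : Finset (Fin k)) : ℕ := Multiset.countP (Crosses A) M

/-- A graph is loopless if no edge has equal ends. -/
def Loopless (M : OrGraph k) : Prop := ∀ a, (a, a) ∉ M

/-- The sets of vertices that are separated from the other vertices by exactly one edge. -/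
def oneCuts (M : OrGraph k) : Finset (Finset (Fin k)) :=
  Finset.univ.filter fun A => M.cross A = 1

/-- An edge is a bridge if it alone separates some set of vertices from the other vertices. -/
def IsBridge (M : OrGraph k) (e : Fin k × Fin k) : Prop := ∃ A, M.cross A = 1 ∧ Crosses A e

/-- The preimage of a set of vertices. -/
def pre (f : Fin k → Fin l) (A : Finset (Fin l)) : Finset (Fin k) :=
  Finset.univ.filter fun x => f x ∈ A

@[simp] theorem mem_pre {f : Fin k → Fin l} {A : Finset (Fin l)} {x : Fin k} :
    x ∈ pre f A ↔ f x ∈ A := by simp [pre]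

theorem mem_oneCuts {M : OrGraph k} {A : Finset (Fin k)} : A ∈ M.oneCuts ↔ M.cross A = 1 := by
  simp [oneCuts]

theorem cross_cons (e : Fin k × Fin k) (M : OrGraph k) (A : Finset (Fin k)) :
    cross (e ::ₘ M) A = cross M A + if Crosses A e then 1 else 0 :=
  Multiset.countP_cons _ _ _

theorem crosses_pre {f : Fin k → Fin l} {A : Finset (Fin l)} {e : Fin k × Fin k} :
    Crosses (pre f A) e ↔ Crosses A (Prod.map f f e) := by simp [Crosses]

theorem cross_mapVertices (f : Fin k → Fin l) (M : OrGraph k) (A : Finset (Fin l)) :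
    cross (mapVertices f M) A = cross M (pre f A) := by
  unfold cross mapVertices
  rw [Multiset.countP_map, ← Multiset.countP_eq_card_filter]
  refine Multiset.countP_congr rfl fun e _ => ?_
  simp [Crosses]

theorem cross_erase_add {M : OrGraph k} {e : Fin k × Fin k} (he : e ∈ M) (A : Finset (Fin k)) :
    cross M A = cross (M.erase e) A + if Crosses A e then 1 else 0 := by
  conv_lhs => rw [← Multiset.cons_erase he]
  rw [cross_cons]

theorem cross_pos {M : OrGraph k} {A : Finset (Fin k)} :
    0 < M.cross A ↔ ∃ e ∈ M, Crosses A e := Multiset.countP_pos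

theorem crosses_swap {A : Finset (Fin k)} {a b : Fin k} : Crosses A (a, b) ↔ Crosses A (b, a) := by
  simp only [Crosses]; tauto

/-- Two edges that cross a set with only one crossing edge coincide. -/
theorem not_crosses_of_mem_erase {M : OrGraph k} {A : Finset (Fin k)} (hA : M.cross A = 1)
    {e f : Fin k × Fin k} (he : e ∈ M) (hce : Crosses A e) (hf : f ∈ M.erase e) :
    ¬ Crosses A f := by
  intro hc
  have h := cross_erase_add he A
  rw [if_pos hce, hA] at h
  have : 0 < cross (M.erase e) A := cross_pos.2 ⟨f, hf, hc⟩
  omega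

/-- Membership in an uncrossed set propagates along walks; conversely, the set of vertices reachable
from a given one is uncrossed. In this form connectedness can be transported by taking preimages of
sets. -/
theorem connected_iff {M : OrGraph k} : M.toSimple.Connected ↔
    Nonempty (Fin k) ∧ ∀ A : Finset (Fin k), A.Nonempty → Aᶜ.Nonempty → 0 < M.cross A := by
  constructor
  · intro h
    refine ⟨h.nonempty, ?_⟩
    rintro A ⟨a, ha⟩ ⟨b, hb⟩
    by_contra hA
    have key : ∀ x y, M.toSimple.Reachable x y → x ∈ A → y ∈ A := by
      rintro x y ⟨w⟩
      induction w with
      | nil => exact id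
      | @cons x y z h _ ih =>
        intro hx
        refine ih ?_
        by_contra hy
        refine hA (cross_pos.2 ?_)
        rcases (toSimple_adj.1 h).2 with h1 | h1
        · exact ⟨_, h1, by simp [Crosses, hx, hy]⟩
        · exact ⟨_, h1, by simp [Crosses, hx, hy]⟩
    exact (Finset.mem_compl.1 hb) (key a b (h.preconnected a b) ha)
  · rintro ⟨hne, h⟩
    classical
    refine SimpleGraph.Connected.mk fun x y => ?_
    by_contra hxy
    obtain ⟨⟨a, b⟩, he, hc⟩ := cross_pos.1 (h (Finset.univ.filter fun z => M.toSimple.Reachable x z)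
      ⟨x, by simp⟩ ⟨y, by simpa using hxy⟩)
    refine hc ?_
    by_cases hab : a = b
    · rw [hab]
    have hadj : M.toSimple.Adj a b := toSimple_adj.2 ⟨hab, Or.inl he⟩
    simp only [Finset.mem_filter, Finset.mem_univ, true_and]
    exact ⟨fun h => h.trans hadj.reachable, fun h => h.trans hadj.symm.reachable⟩

theorem valence_perm (σ : Equiv.Perm (Fin k)) (M : OrGraph k) (v : Fin k) :
    valence (mapVertices σ M) (σ v) = valence M v := by
  unfold valence mapVertices
  rw [Multiset.countP_map, ← Multiset.countP_eq_card_filter, Multiset.countP_map,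
    ← Multiset.countP_eq_card_filter]
  simp

theorem valence_flip (a b : Fin k) (M : OrGraph k) (v : Fin k) :
    valence ((b, a) ::ₘ M) v = valence ((a, b) ::ₘ M) v := by
  simp only [valence_cons]; omega

theorem cross_flip (a b : Fin k) (M : OrGraph k) (A : Finset (Fin k)) :
    cross ((b, a) ::ₘ M) A = cross ((a, b) ::ₘ M) A := by
  rw [cross_cons, cross_cons]
  simp only [crosses_swap (a := a)]

/-! ### Lobes -/

/-- The set `S` is a union of connected components of the graph without the vertex `v`. -/
def Closed (M : OrGraph k) (v : Fin k) (S : Finset (Fin k)) : Prop :=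
  ∀ x y, (x, y) ∈ M → x ≠ v → y ≠ v → (x ∈ S ↔ y ∈ S)

/-- A lobe at the cut vertex `v` is a connected component `S` of the graph without `v` that is
joined to `v` by at least two edges. -/
structure IsLobe (M : OrGraph k) (v : Fin k) (S : Finset (Fin k)) : Prop where
  notMem : v ∉ S
  nonempty : S.Nonempty
  exists_outside : ∃ b, b ∉ S ∧ b ≠ v
  closed : M.Closed v S
  two_le : 2 ≤ M.cross S
  eq_of_closed : ∀ T ⊆ S, T.Nonempty → M.Closed v T → T = S

open Classical in
/-- The lobes of a graph with their cut vertices. -/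
def lobes (M : OrGraph k) : Finset (Fin k × Finset (Fin k)) :=
  Finset.univ.filter fun x => M.IsLobe x.1 x.2

@[simp] theorem mem_lobes {M : OrGraph k} {x : Fin k × Finset (Fin k)} :
    x ∈ M.lobes ↔ M.IsLobe x.1 x.2 := by simp [lobes]

/-- Closedness forces one end of a crossing edge to be `v`. Loops need no exclusion, since they
cross nothing and `v ∉ S` makes the right side false for them. -/
theorem Closed.crosses_iff {M : OrGraph k} {v : Fin k} {S : Finset (Fin k)} (h : M.Closed v S)
    (hv : v ∉ S) {x y : Fin k} (he : (x, y) ∈ M) :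
    Crosses S (x, y) ↔ (x = v ∧ y ∈ S) ∨ (y = v ∧ x ∈ S) := by
  have := h x y he
  simp only [Crosses]
  by_cases hx : x = v
  · subst hx; by_cases hy : y = x
    · subst hy; simp [hv]
    · simp [hv, hy]
  · by_cases hy : y = v
    · subst hy; simp [hv, hx]
    · simp [hx, hy, this hx hy]

/-- A graph with a cut vertex that belongs to the complex has a lobe. -/
theorem exists_isLobe {M : OrGraph k} (hM : M.Admissible) (hl : M.Loopless) {c : Fin k}
    (hc : M.IsCutVertex c) : ∃ v S, M.IsLobe v S := by
  classical
  -- The set `S` is taken of least size over all vertices `v` simultaneously. Varying `S` at fixed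
  -- `v` shows that it is a component; varying `v` excludes a single joining edge.
  let P : ℕ → Prop := fun n => ∃ v : Fin k, ∃ S : Finset (Fin k), v ∉ S ∧ S.Nonempty ∧
    (∃ b, b ∉ S ∧ b ≠ v) ∧ M.Closed v S ∧ S.card = n
  have hP : ∃ n, P n := by
    obtain ⟨S, ⟨a, haS, ha⟩, ⟨b, hbS, hb⟩, hS⟩ := isCutVertex_iff.1 hc
    refine ⟨_, c, Finset.univ.filter fun x => x ∈ S ∧ x ≠ c, by simp, ⟨a, by simp [haS, ha]⟩,
      ⟨b, by simp [hbS], hb⟩, fun x y hxy hx hy => ?_, rfl⟩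
    simp [hx, hy, hS x y hxy hx hy]
  obtain ⟨v, S, hvS, hne, ⟨b, hbS, hb⟩, hcl, hcard⟩ := Nat.find_spec hP
  have hmin : ∀ (w : Fin k) (T : Finset (Fin k)), w ∉ T → T.Nonempty → (∃ b, b ∉ T ∧ b ≠ w) →
      M.Closed w T → S.card ≤ T.card := by
    intro w T h1 h2 h3 h4
    rw [hcard]
    exact Nat.find_min' hP ⟨w, T, h1, h2, h3, h4, rfl⟩
  refine ⟨v, S, hvS, hne, ⟨b, hbS, hb⟩, hcl, ?_, fun T hTS hT hTc => ?_⟩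
  · by_contra hlt
    have hpos : 0 < M.cross S := (connected_iff.1 hM.connected).2 S hne ⟨b, by simpa using hbS⟩
    have hone : M.cross S = 1 := by omega
    obtain ⟨⟨x, y⟩, he, hce⟩ := cross_pos.1 hpos
    -- If only one edge joins `S` to `v`, its end `u` in `S` is itself a vertex that cuts off the
    -- smaller set `S.erase u`.
    obtain ⟨u, huS, hu⟩ : ∃ u ∈ S, (x, y) = (u, v) ∨ (x, y) = (v, u) := by
      rcases (hcl.crosses_iff hvS he).1 hce with ⟨rfl, h⟩ | ⟨rfl, h⟩
      · exact ⟨y, h, Or.inr rfl⟩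
      · exact ⟨x, h, Or.inl rfl⟩
    have huv : u ≠ v := fun h => hvS (h ▸ huS)
    have hedge : ∀ a b, (a, b) ∈ M.erase (x, y) → (a ∈ S ↔ b ∈ S) := fun a b hab =>
      not_not.1 (not_crosses_of_mem_erase hone he hce hab)
    -- Valence at least `3` gives `u` another edge. It is not a loop and does not leave `S`, so
    -- `S.erase u` is nonempty.
    obtain ⟨w, hw⟩ : ∃ w, (u, w) ∈ M.erase (x, y) ∨ (w, u) ∈ M.erase (x, y) := by
      refine exists_edge_of_valence_pos ?_
      have h3 := hM.three_le_valence u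
      rw [← Multiset.cons_erase he, valence_cons] at h3
      split_ifs at h3 <;> omega
    have hwu : w ≠ u := by
      rintro rfl
      rcases hw with hw | hw <;> exact hl _ (Multiset.mem_of_mem_erase hw)
    have hwS : w ∈ S := by
      rcases hw with hw | hw
      · exact (hedge _ _ hw).1 huS
      · exact (hedge _ _ hw).2 huS
    have := hmin u (S.erase u) (by simp) ⟨w, by simp [hwu, hwS]⟩ ⟨v, by simp [hvS], huv.symm⟩ (by
      intro s t hst hs ht
      simp only [Finset.mem_erase, hs, ht, ne_eq, not_false_eq_true, true_and]
      refine hedge s t ((Multiset.mem_erase_of_ne ?_).2 hst)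
      rintro h
      rcases hu with hu | hu <;> rw [hu, Prod.mk.injEq] at h
      · exact hs h.1
      · exact ht h.2)
    rw [Finset.card_erase_of_mem huS] at this
    have := Finset.card_pos.2 hne
    omega
  · refine Finset.eq_of_subset_of_card_le hTS (hmin v T (fun h => hvS (hTS h)) hT
      ⟨b, fun h => hbS (hTS h), hb⟩ hTc)

end OrGraph

/-! ### Pulling a lobe off its cut vertex -/

namespace OrGraph

variable {k : ℕ}

/-- The effect on an edge of pulling `S` off `v`: the ends at `v` of the edges between `v` and `S` are
moved to the new vertex `Fin.last k`. -/
def redirect (v : Fin k) (S : Finset (Fin k)) (e : Fin k × Fin k) : Fin (k + 1) × Fin (k + 1) :=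
  (if e.1 = v ∧ e.2 ∈ S then Fin.last k else e.1.castSucc,
    if e.2 = v ∧ e.1 ∈ S then Fin.last k else e.2.castSucc)

/-- The graph obtained by pulling `S` off `v`: the ends at `v` of the edges between `v` and `S` are
moved to a new vertex, which is joined to `v` by a new edge. -/
def pull (M : OrGraph k) (v : Fin k) (S : Finset (Fin k)) : OrGraph (k + 1) :=
  (v.castSucc, Fin.last k) ::ₘ Multiset.map (redirect v S) M

@[simp] theorem merge_last_castSucc (v x : Fin k) : merge (Fin.last k) v x.castSucc = x := by
  rw [← Fin.succAbove_last_apply, merge_succAbove]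

theorem merge_last_redirect (v : Fin k) (S : Finset (Fin k)) (e : Fin k × Fin k) :
    Prod.map (merge (Fin.last k) v) (merge (Fin.last k) v) (redirect v S e) = e := by
  obtain ⟨a, b⟩ := e
  simp only [redirect, Prod.map_apply, Prod.mk.injEq]
  constructor
  · split_ifs with h
    · rw [merge_same, h.1]
    · simp
  · split_ifs with h
    · rw [merge_same, h.1]
    · simp

theorem redirect_swap (v : Fin k) (S : Finset (Fin k)) (a b : Fin k) :
    redirect v S (b, a) = ((redirect v S (a, b)).2, (redirect v S (a, b)).1) := rfl

theorem mapVertices_redirect (M : OrGraph k) (v : Fin k) (S : Finset (Fin k)) :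
    mapVertices (merge (Fin.last k) v) (Multiset.map (redirect v S) M) = M := by
  rw [mapVertices, Multiset.map_map]
  conv_rhs => rw [← Multiset.map_id M]
  exact Multiset.map_congr rfl fun e _ => merge_last_redirect v S e

/-- The new edge turns into a loop at `v`. A loop crosses no set and adds `2` to the valence of `v`,
so cuts and valences of the pulled graph can be read off from `M`. -/
theorem mapVertices_pull (M : OrGraph k) (v : Fin k) (S : Finset (Fin k)) :
    mapVertices (merge (Fin.last k) v) (pull M v S) = (v, v) ::ₘ M := by
  rw [pull, mapVertices_cons, mapVertices_redirect, merge_same, merge_last_castSucc]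

theorem cross_pull_pre (M : OrGraph k) (v : Fin k) (S A : Finset (Fin k)) :
    cross (pull M v S) (pre (merge (Fin.last k) v) A) = cross M A := by
  rw [← cross_mapVertices, mapVertices_pull, cross_cons]
  simp [Crosses]

/-- A cut of the pulled graph thus either separates the ends of the new edge or comes from a cut of
`M`. -/
theorem eq_pre_of_not_crosses {v : Fin k} {A : Finset (Fin (k + 1))}
    (h : ¬ Crosses A (v.castSucc, Fin.last k)) :
    A = pre (merge (Fin.last k) v) (pre Fin.castSucc A) := by
  ext x
  induction x using Fin.lastCases with
  | last => simp only [Crosses, not_not] at h; simp [h]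
  | cast x => simp

theorem pull_cons (M : OrGraph k) (e : Fin k × Fin k) (v : Fin k) (S : Finset (Fin k)) :
    pull (e ::ₘ M) v S = redirect v S e ::ₘ pull M v S := by
  rw [pull, Multiset.map_cons, Multiset.cons_swap]; rfl

theorem pull_erase {M : OrGraph k} {e : Fin k × Fin k} (he : e ∈ M) (v : Fin k)
    (S : Finset (Fin k)) : (pull M v S).erase (redirect v S e) = pull (M.erase e) v S := by
  conv_lhs => rw [← Multiset.cons_erase he, pull_cons, Multiset.erase_cons_head]

theorem connected_pull {M : OrGraph k} (hM : M.toSimple.Connected) (v : Fin k)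
    (S : Finset (Fin k)) : (pull M v S).toSimple.Connected := by
  rw [connected_iff] at hM ⊢
  refine ⟨⟨Fin.last k⟩, fun A hA hA' => ?_⟩
  by_cases h : Crosses A (v.castSucc, Fin.last k)
  · exact cross_pos.2 ⟨_, Multiset.mem_cons_self _ _, h⟩
  · have hpre := eq_pre_of_not_crosses h
    rw [hpre] at hA hA' ⊢
    rw [cross_pull_pre]
    refine hM.2 _ ?_ ?_
    · obtain ⟨x, hx⟩ := hA
      exact ⟨_, mem_pre.1 hx⟩
    · obtain ⟨x, hx⟩ := hA'
      exact ⟨merge (Fin.last k) v x, by simpa using hx⟩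

/-- The new vertex receives one half-edge from each edge between `S` and `v`, and one from the new
edge. -/
theorem valence_pull_last {M : OrGraph k} {v : Fin k} {S : Finset (Fin k)} (hv : v ∉ S)
    (hc : M.Closed v S) : valence (pull M v S) (Fin.last k) = M.cross S + 1 := by
  have h : ∀ M : OrGraph k, M.Closed v S →
      valence (Multiset.map (redirect v S) M) (Fin.last k) = M.cross S := by
    intro M
    induction M using Multiset.induction_on with
    | empty => simp [valence, cross]
    | cons e M ih =>
      intro hc
      obtain ⟨a, b⟩ := e
      rw [Multiset.map_cons, valence_cons, cross_cons,
        ih fun x y h => hc x y (Multiset.mem_cons_of_mem h)]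
      have := hc.crosses_iff hv (Multiset.mem_cons_self (a, b) M)
      simp only [redirect, this]
      by_cases h1 : a = v ∧ b ∈ S
      · have h2 : ¬ (b = v ∧ a ∈ S) := fun h => hv (h1.1 ▸ h.2)
        simp [h1, Fin.castSucc_ne_last]
        rintro rfl; exact absurd h1.2 hv
      · by_cases h2 : b = v ∧ a ∈ S
        · simp [h2, Fin.castSucc_ne_last]
          rintro rfl; exact absurd h2.2 hv
        · simp [h1, h2, Fin.castSucc_ne_last]
  rw [pull, valence_cons, h M hc]
  simp [Fin.castSucc_ne_last]

/-- The vertex `v` loses its half-edges towards `S` and gains one from the new edge. The additive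
form avoids truncated subtraction. -/
theorem valence_pull_castSucc {M : OrGraph k} {v : Fin k} {S : Finset (Fin k)} (hv : v ∉ S)
    (hc : M.Closed v S) (x : Fin k) : valence (pull M v S) x.castSucc + (if x = v then M.cross S else 0)
      = valence M x + if x = v then 1 else 0 := by
  have h := valence_merge (Fin.last k) v (pull M v S) x
  rw [mapVertices_pull, valence_cons, valence_pull_last hv hc, Fin.succAbove_last_apply] at h
  by_cases hx : x = v
  · subst hx; simp only [if_true] at h ⊢; omega
  · have hx' : ¬ v = x := fun h => hx h.symm
    simp only [hx, hx', if_false] at h ⊢; omega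

theorem loopless_pull {M : OrGraph k} (hM : M.Loopless) (v : Fin k) (S : Finset (Fin k)) :
    (pull M v S).Loopless := by
  intro a ha
  rcases Multiset.mem_cons.1 ha with h | h
  · rw [Prod.mk.injEq] at h
    exact (Fin.castSucc_lt_last v).ne (h.1.symm.trans h.2)
  · obtain ⟨⟨x, y⟩, he, hxy⟩ := Multiset.mem_map.1 h
    have := congrArg (Prod.map (merge (Fin.last k) v) (merge (Fin.last k) v)) hxy
    rw [merge_last_redirect, Prod.map_apply, Prod.mk.injEq] at this
    rw [this.1, this.2] at he
    exact hM _ he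

/-- A lobe can be pulled off if there are at least two further half-edges at its cut vertex. -/
def Pullable (M : OrGraph k) (x : Fin k × Finset (Fin k)) : Prop :=
  M.cross x.2 + 2 ≤ M.valence x.1

instance (M : OrGraph k) : DecidablePred (Pullable M) := fun _ => inferInstanceAs (Decidable (_ ≤ _))

/-- The two valences at risk are those of the ends of the new edge: `two_le` secures the new vertex,
and pullability secures `v`. -/
theorem admissible_pull {M : OrGraph k} (hM : M.Admissible) {v : Fin k} {S : Finset (Fin k)}
    (hS : M.IsLobe v S) (hp : M.Pullable (v, S)) : (pull M v S).Admissible := by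
  refine ⟨connected_pull hM.connected v S, fun x => ?_⟩
  induction x using Fin.lastCases with
  | last =>
    rw [valence_pull_last hS.notMem hS.closed]
    have := hS.two_le
    omega
  | cast x =>
    have h1 := valence_pull_castSucc hS.notMem hS.closed x
    have h2 := hM.three_le_valence x
    by_cases hx : x = v
    · subst hx
      have h3 : M.cross S + 2 ≤ M.valence x := hp
      simp only [if_true] at h1
      omega
    · simp only [hx, if_false] at h1
      omega

/-- Edges between `S` and `v` now end at the new vertex, so only the new edge leaves the lobe
enlarged by that vertex. -/
theorem not_crosses_redirect {v : Fin k} {S : Finset (Fin k)} (hv : v ∉ S) {x y : Fin k}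
    (h : Crosses S (x, y) ↔ (x = v ∧ y ∈ S) ∨ (y = v ∧ x ∈ S)) :
    ¬ Crosses (insert (Fin.last k) (S.map Fin.castSuccEmb)) (redirect v S (x, y)) := by
  have hmem : ∀ z : Fin k, z.castSucc ∈ insert (Fin.last k) (S.map Fin.castSuccEmb) ↔ z ∈ S := by
    intro z
    simp [Fin.castSucc_ne_last]
  rw [Crosses] at h
  rw [Crosses, not_not, redirect]
  simp only
  by_cases h1 : x = v ∧ y ∈ S
  · have h2 : ¬ (y = v ∧ x ∈ S) := fun h => hv (h1.1 ▸ h.2)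
    rw [if_pos h1, if_neg h2, hmem]
    simp [h1.2]
  · by_cases h2 : y = v ∧ x ∈ S
    · rw [if_neg h1, if_pos h2, hmem]
      simp [h2.2]
    · rw [if_neg h1, if_neg h2, hmem, hmem]
      tauto

theorem cross_pull_lobe {M : OrGraph k} {v : Fin k} {S : Finset (Fin k)} (hv : v ∉ S)
    (hc : M.Closed v S) : cross (pull M v S) (insert (Fin.last k) (S.map Fin.castSuccEmb)) = 1 := by
  rw [pull, cross_cons, if_pos (by simp [Crosses, hv])]
  have : ¬ 0 < cross (Multiset.map (redirect v S) M) (insert (Fin.last k) (S.map Fin.castSuccEmb)) := by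
    rw [cross_pos]
    rintro ⟨e, he, hce⟩
    obtain ⟨⟨x, y⟩, hxy, rfl⟩ := Multiset.mem_map.1 he
    exact not_crosses_redirect hv (hc.crosses_iff hv hxy) hce
  omega

/-- The new vertex separates the lobe from `v`; hence the homotopy operator stays inside `𝒞`. -/
theorem isCutVertex_pull {M : OrGraph k} {v : Fin k} {S : Finset (Fin k)} (hS : M.IsLobe v S) :
    (pull M v S).IsCutVertex (Fin.last k) := by
  rw [isCutVertex_iff]
  obtain ⟨a, ha⟩ := hS.nonempty
  refine ⟨↑(insert (Fin.last k) (S.map Fin.castSuccEmb)), ⟨a.castSucc, by simp [ha],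
    Fin.castSucc_ne_last a⟩, ⟨v.castSucc, by simp [hS.notMem], Fin.castSucc_ne_last v⟩, ?_⟩
  intro x y hxy hx hy
  rcases Multiset.mem_cons.1 hxy with h | h
  · rw [Prod.mk.injEq] at h
    exact absurd h.2 hy
  · obtain ⟨⟨s, t⟩, hst, he⟩ := Multiset.mem_map.1 h
    have := not_crosses_redirect hS.notMem (hS.closed.crosses_iff hS.notMem hst)
    rw [he, Crosses, not_not] at this
    exact this

/-- Cuts of `M` pull back to sets that keep `v` and the new vertex together, whereas the lobe with
the new vertex separates them. The complement is a further new cut, but one suffices to raise the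
filtration. -/
theorem card_oneCuts_pull {M : OrGraph k} {v : Fin k} {S : Finset (Fin k)} (hv : v ∉ S)
    (hc : M.Closed v S) : M.oneCuts.card + 1 ≤ (pull M v S).oneCuts.card := by
  have hinj : Function.Injective (pre (merge (Fin.last k) v)) := by
    intro A A' h
    ext x
    have := congrArg (fun B => x.castSucc ∈ B) h
    simpa using this
  rw [← Finset.card_image_of_injective M.oneCuts hinj]
  have hnot : insert (Fin.last k) (S.map Fin.castSuccEmb) ∉
      M.oneCuts.image (pre (merge (Fin.last k) v)) := by
    rw [Finset.mem_image]
    rintro ⟨A, _, hA⟩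
    have h1 : Fin.last k ∈ pre (merge (Fin.last k) v) A := by rw [hA]; simp
    have h2 : v.castSucc ∈ pre (merge (Fin.last k) v) A := by
      rw [mem_pre, merge_last_castSucc]
      rwa [mem_pre, merge_same] at h1
    rw [hA] at h2
    simp [hv] at h2
  rw [← Finset.card_insert_of_notMem hnot]
  refine Finset.card_le_card ?_
  rw [Finset.insert_subset_iff]
  refine ⟨mem_oneCuts.2 (cross_pull_lobe hv hc), ?_⟩
  intro B hB
  obtain ⟨A, hA, rfl⟩ := Finset.mem_image.1 hB
  rw [mem_oneCuts, cross_pull_pre]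
  exact mem_oneCuts.1 hA

/-- A set crossed only by the redirected edge is not crossed by the new edge, hence comes from a set
of vertices of `M`. Contrapositively, an edge that is not a bridge does not become one by pulling.
-/
theorem IsBridge.of_pull {M : OrGraph k} {v : Fin k} {S : Finset (Fin k)} {e : Fin k × Fin k}
    (he : e ∈ M) (h : (pull M v S).IsBridge (redirect v S e)) : M.IsBridge e := by
  obtain ⟨A, hA, hce⟩ := h
  have hnew : ¬ Crosses A (v.castSucc, Fin.last k) := by
    intro hnew
    refine not_crosses_of_mem_erase hA (Multiset.mem_cons_self _ _) hnew ?_ hce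
    rw [pull, Multiset.erase_cons_head]
    exact Multiset.mem_map_of_mem _ he
  have hpre := eq_pre_of_not_crosses hnew
  rw [hpre] at hA hce
  rw [cross_pull_pre] at hA
  refine ⟨_, hA, ?_⟩
  rwa [crosses_pre, merge_last_redirect] at hce

/-- The graph obtained by collapsing the edge from `j.succAbove p` to `j`. -/
def contract (M : OrGraph (k + 1)) (j : Fin (k + 1)) (p : Fin k) : OrGraph k :=
  mapVertices (merge j p) (M.erase (j.succAbove p, j))

theorem cross_contract {M : OrGraph (k + 1)} {j : Fin (k + 1)} {p : Fin k}
    (he : (j.succAbove p, j) ∈ M) (A : Finset (Fin k)) :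
    cross (contract M j p) A = cross M (pre (merge j p) A) := by
  rw [contract, cross_mapVertices, cross_erase_add he]
  simp [Crosses]

/-- Sets not crossed by the collapsed edge are determined by their image in the collapsed graph. By
`IsLobe.not_crosses` this applies to lobes when the edge is a bridge. -/
theorem eq_pre_of_saturated {j : Fin (k + 1)} {p : Fin k} {A : Finset (Fin (k + 1))}
    (h : ¬ Crosses A (j.succAbove p, j)) : A = pre (merge j p) (pre j.succAbove A) := by
  ext x
  by_cases hx : x = j
  · subst hx; simp only [Crosses, not_not] at h; simp [h]
  · obtain ⟨q, rfl⟩ := Fin.exists_succAbove_eq hx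
    simp

/-- Collapsing an edge that is not a bridge preserves the sets that are separated by one edge. -/
theorem card_oneCuts_contract {M : OrGraph (k + 1)} {j : Fin (k + 1)} {p : Fin k}
    (he : (j.succAbove p, j) ∈ M) (hb : ¬ M.IsBridge (j.succAbove p, j)) :
    M.oneCuts.card ≤ (contract M j p).oneCuts.card := by
  have hsat : ∀ A ∈ M.oneCuts, A = pre (merge j p) (pre j.succAbove A) := fun A hA =>
    eq_pre_of_saturated fun h => hb ⟨A, mem_oneCuts.1 hA, h⟩
  refine Finset.card_le_card_of_injOn (pre j.succAbove) (fun A hA => ?_) fun A hA A' hA' h => ?_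
  · rw [Finset.mem_coe, mem_oneCuts, cross_contract he, ← hsat A hA]
    exact mem_oneCuts.1 hA
  · rw [hsat A hA, hsat A' hA', h]

end OrGraph

/-! ### The homotopy operator -/

section Homotopy

variable (K : Type*) [Field K] {k : ℕ}

/-- The contribution of a lobe to the homotopy operator. -/
def pullTerm (M : OrGraph k) (x : Fin k × Finset (Fin k)) : GraphSpace K (k + 1) :=
  if M.Pullable x then (-1 : K) ^ k • cls K (pull M x.1 x.2) else 0

/-- The average of the graphs obtained from `M` by pulling off a lobe. -/
def homotopyGraph (M : OrGraph k) : GraphSpace K (k + 1) :=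
  ((M.lobes.card : K))⁻¹ • ∑ x ∈ M.lobes, pullTerm K M x

variable {K}

/-! ### Compatibility of the homotopy operator with orientations -/

theorem pull_flip (a b : Fin k) (M : OrGraph k) (v : Fin k) (S : Finset (Fin k)) :
    cls K (pull ((b, a) ::ₘ M) v S) = - cls K (pull ((a, b) ::ₘ M) v S) := by
  rw [pull_cons, pull_cons, redirect_swap, cls_flip]

theorem closed_flip {a b : Fin k} {M : OrGraph k} {v : Fin k} {S : Finset (Fin k)}
    (h : OrGraph.Closed ((a, b) ::ₘ M) v S) : OrGraph.Closed ((b, a) ::ₘ M) v S := by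
  intro x y hxy hx hy
  rcases Multiset.mem_cons.1 hxy with h1 | h1
  · obtain ⟨rfl, rfl⟩ := Prod.mk.inj h1
    exact (h _ _ (Multiset.mem_cons_self _ _) hy hx).symm
  · exact h x y (Multiset.mem_cons_of_mem h1) hx hy

theorem isLobe_flip {a b : Fin k} {M : OrGraph k} {v : Fin k} {S : Finset (Fin k)}
    (h : OrGraph.IsLobe ((a, b) ::ₘ M) v S) : OrGraph.IsLobe ((b, a) ::ₘ M) v S :=
  ⟨h.notMem, h.nonempty, h.exists_outside, closed_flip h.closed, by rw [cross_flip]; exact h.two_le,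
    fun T hT hne hc => h.eq_of_closed T hT hne (closed_flip hc)⟩

theorem lobes_flip (a b : Fin k) (M : OrGraph k) :
    OrGraph.lobes ((b, a) ::ₘ M) = OrGraph.lobes ((a, b) ::ₘ M) := by
  ext x
  rw [mem_lobes, mem_lobes]
  exact ⟨isLobe_flip, isLobe_flip⟩

theorem homotopyGraph_flip (a b : Fin k) (M : OrGraph k) :
    homotopyGraph K ((b, a) ::ₘ M) = - homotopyGraph K ((a, b) ::ₘ M) := by
  rw [homotopyGraph, homotopyGraph, lobes_flip, ← smul_neg, ← Finset.sum_neg_distrib]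
  congr 1
  refine Finset.sum_congr rfl fun x _ => ?_
  have hp : Pullable ((b, a) ::ₘ M) x ↔ Pullable ((a, b) ::ₘ M) x := by
    rw [Pullable, Pullable, cross_flip, valence_flip]
  simp only [pullTerm, hp]
  split_ifs
  · rw [pull_flip, smul_neg]
  · rw [neg_zero]

/-- The permutation of the vertices of the graph with a new last vertex. -/
def extendPerm (σ : Equiv.Perm (Fin k)) : Equiv.Perm (Fin (k + 1)) :=
  finSuccEquivLast.symm.permCongr (Equiv.optionCongr σ)

@[simp] theorem extendPerm_castSucc (σ : Equiv.Perm (Fin k)) (x : Fin k) :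
    extendPerm σ x.castSucc = (σ x).castSucc := by
  simp [extendPerm, Equiv.permCongr_apply]

@[simp] theorem extendPerm_last (σ : Equiv.Perm (Fin k)) :
    extendPerm σ (Fin.last k) = Fin.last k := by
  simp [extendPerm, Equiv.permCongr_apply]

theorem sign_extendPerm (σ : Equiv.Perm (Fin k)) :
    Equiv.Perm.sign (extendPerm σ) = Equiv.Perm.sign σ := by
  rw [extendPerm, Equiv.Perm.sign_permCongr, Equiv.optionCongr_sign]

theorem pull_perm (σ : Equiv.Perm (Fin k)) (M : OrGraph k) (v : Fin k) (S : Finset (Fin k)) :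
    pull (mapVertices σ M) (σ v) (S.map σ.toEmbedding)
      = mapVertices (extendPerm σ) (pull M v S) := by
  rw [pull, pull, mapVertices_cons, extendPerm_castSucc, extendPerm_last]
  congr 1
  rw [mapVertices, mapVertices, Multiset.map_map, Multiset.map_map]
  refine Multiset.map_congr rfl fun e _ => ?_
  simp only [Function.comp_apply, redirect, Prod.map_apply, Prod.map_fst, Prod.map_snd,
    EmbeddingLike.apply_eq_iff_eq, Finset.mem_map_equiv, Equiv.symm_apply_apply, apply_ite (extendPerm σ),
    extendPerm_castSucc, extendPerm_last]

theorem pre_perm (σ : Equiv.Perm (Fin k)) (S : Finset (Fin k)) :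
    pre σ (S.map σ.toEmbedding) = S := by
  ext x; simp

theorem closed_perm {σ : Equiv.Perm (Fin k)} {M : OrGraph k} {v : Fin k} {S : Finset (Fin k)} :
    OrGraph.Closed (mapVertices σ M) (σ v) S ↔ M.Closed v (pre σ S) := by
  constructor
  · intro h x y hxy hx hy
    rw [mem_pre, mem_pre]
    exact h _ _ (mem_mapVertices hxy) (fun h => hx (σ.injective h)) (fun h => hy (σ.injective h))
  · intro h x y hxy hx hy
    obtain ⟨s, t, hst, rfl, rfl⟩ := exists_of_mem_mapVertices hxy
    rw [← mem_pre, ← mem_pre]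
    exact h s t hst (fun h => hx (by rw [h])) (fun h => hy (by rw [h]))

theorem isLobe_perm {σ : Equiv.Perm (Fin k)} {M : OrGraph k} {v : Fin k} {S : Finset (Fin k)} :
    OrGraph.IsLobe (mapVertices σ M) (σ v) (S.map σ.toEmbedding) ↔ M.IsLobe v S := by
  have hmap : ∀ T : Finset (Fin k), (pre σ T).map σ.toEmbedding = T := by
    intro T; ext x; simp [Finset.mem_map_equiv]
  constructor
  · intro h
    refine ⟨by simpa using h.notMem, by simpa using h.nonempty, ?_, ?_, ?_, ?_⟩
    · obtain ⟨b, hb, hbv⟩ := h.exists_outside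
      exact ⟨σ.symm b, by simpa [Finset.mem_map_equiv] using hb,
        fun h => hbv (by rw [← h, Equiv.apply_symm_apply])⟩
    · have := closed_perm.1 h.closed
      rwa [pre_perm] at this
    · have := h.two_le
      rwa [cross_mapVertices, pre_perm] at this
    · intro T hT hne hc
      have := h.eq_of_closed (T.map σ.toEmbedding) (Finset.map_subset_map.2 hT) (by simpa using hne)
        (closed_perm.2 (by rwa [pre_perm]))
      exact Finset.map_injective _ this
  · intro h
    refine ⟨by simpa using h.notMem, by simpa using h.nonempty, ?_, ?_, ?_, ?_⟩
    · obtain ⟨b, hb, hbv⟩ := h.exists_outside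
      exact ⟨σ b, by simpa using hb, by simpa using hbv⟩
    · rw [closed_perm, pre_perm]; exact h.closed
    · rw [cross_mapVertices, pre_perm]; exact h.two_le
    · intro T hT hne hc
      rw [← hmap T] at hT ⊢
      rw [h.eq_of_closed (pre σ T) (Finset.map_subset_map.1 hT) ?_ (closed_perm.1 hc)]
      rw [← hmap T] at hne
      simpa using hne

/-- The action of a permutation on the pairs of a vertex and a set of vertices. -/
def pairPerm (σ : Equiv.Perm (Fin k)) : Fin k × Finset (Fin k) ≃ Fin k × Finset (Fin k) :=
  σ.prodCongr σ.finsetCongr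

theorem homotopyGraph_perm (σ : Equiv.Perm (Fin k)) (M : OrGraph k) :
    homotopyGraph K (mapVertices σ M) = ((Equiv.Perm.sign σ : ℤ) : K) • homotopyGraph K M := by
  have hl : OrGraph.lobes (mapVertices σ M) = M.lobes.map (pairPerm σ).toEmbedding := by
    ext x
    obtain ⟨⟨v, S⟩, rfl⟩ := (pairPerm σ).surjective x
    rw [Finset.mem_map_equiv, Equiv.symm_apply_apply, mem_lobes, mem_lobes]
    exact isLobe_perm
  rw [homotopyGraph, homotopyGraph, hl, Finset.card_map, Finset.sum_map, smul_comm]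
  congr 1
  rw [Finset.smul_sum]
  refine Finset.sum_congr rfl fun x _ => ?_
  obtain ⟨v, S⟩ := x
  change pullTerm K (mapVertices σ M) (σ v, S.map σ.toEmbedding) = _
  have hp : Pullable (mapVertices σ M) (σ v, S.map σ.toEmbedding) ↔ Pullable M (v, S) := by
    rw [Pullable, Pullable, valence_perm, cross_mapVertices, pre_perm]
  simp only [pullTerm, hp, pull_perm, cls_mapVertices, sign_extendPerm]
  split_ifs
  · rw [smul_comm]
  · rw [smul_zero]

variable (K k)

/-- The homotopy operator on the space of oriented graphs: a graph is sent to the average of the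
graphs obtained from it by pulling off a lobe. -/
def homotopy : GraphSpace K k →ₗ[K] GraphSpace K (k + 1) :=
  (orientationRelations K k).liftQ
    (Finsupp.linearCombination K (homotopyGraph K (k := k))) (by
      refine Submodule.span_le.2 ?_
      rintro r (⟨σ, M, rfl⟩ | ⟨a, b, M, rfl⟩)
      · simp [homotopyGraph_perm]
      · rw [SetLike.mem_coe, LinearMap.mem_ker, map_add, Finsupp.linearCombination_single,
          Finsupp.linearCombination_single, one_smul, one_smul, homotopyGraph_flip, neg_add_cancel])

variable {K k}

@[simp] theorem homotopy_cls (M : OrGraph k) : homotopy K k (cls K M) = homotopyGraph K M := by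
  change Finsupp.linearCombination K (homotopyGraph K (k := k)) (Finsupp.single M 1) = _
  simp

/-- The sign records that the new vertex has index `k`; the factor in `pullTerm` is there to cancel
it. -/
theorem collapse_pull_new (M : OrGraph k) (v : Fin k) (S : Finset (Fin k)) :
    collapse K (pull M v S) (v.castSucc, Fin.last k) = (-1 : K) ^ k • cls K M := by
  have h := collapse_edge (K := K) (pull M v S) (Fin.last k) v
  rw [Fin.succAbove_last_apply] at h
  rw [h, pull, Multiset.erase_cons_head, mapVertices_redirect, Fin.val_last]

theorem boundaryGraph_pull (M : OrGraph k) (v : Fin k) (S : Finset (Fin k)) :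
    boundaryGraph K (pull M v S) = (-1 : K) ^ k • cls K M +
      (Multiset.map (fun e => collapse K (pull M v S) (redirect v S e)) M).sum := by
  rw [boundaryGraph]
  conv_lhs => enter [1, 2]; rw [pull]
  rw [Multiset.map_cons, Multiset.sum_cons, collapse_pull_new, Multiset.map_map]
  rfl

theorem collapse_eq_contract (M : OrGraph (k + 1)) (j : Fin (k + 1)) (p : Fin k) :
    collapse K M (j.succAbove p, j) = (-1 : K) ^ (j : ℕ) • cls K (contract M j p) :=
  collapse_edge M j p

end Homotopy

/-! ### Lobes and bridges -/

namespace OrGraph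

variable {k : ℕ}

theorem merge_eq_merge {j : Fin (k + 1)} {p : Fin k} {x y : Fin (k + 1)}
    (h : merge j p x = merge j p y) (hxy : x ≠ y) :
    (x = j ∧ y = j.succAbove p) ∨ (x = j.succAbove p ∧ y = j) := by
  by_cases hx : x = j
  · subst hx
    obtain ⟨q, rfl⟩ := Fin.exists_succAbove_eq hxy.symm
    rw [merge_same, merge_succAbove] at h
    exact Or.inl ⟨rfl, by rw [h]⟩
  · obtain ⟨q, rfl⟩ := Fin.exists_succAbove_eq hx
    by_cases hy : y = j
    · subst hy
      rw [merge_same, merge_succAbove] at h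
      exact Or.inr ⟨by rw [h], rfl⟩
    · obtain ⟨r, rfl⟩ := Fin.exists_succAbove_eq hy
      rw [merge_succAbove, merge_succAbove] at h
      exact absurd (by rw [h]) hxy

theorem Closed.crosses_insert_iff {M : OrGraph k} {v : Fin k} {S : Finset (Fin k)}
    (h : M.Closed v S) {x y : Fin k} (he : (x, y) ∈ M) (hxy : x ≠ y) :
    Crosses (insert v S) (x, y) ↔ (x = v ∧ y ∉ S) ∨ (y = v ∧ x ∉ S) := by
  have := h x y he
  simp only [Crosses, Finset.mem_insert]
  by_cases hx : x = v
  · subst hx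
    simp [hxy.symm]
  · by_cases hy : y = v
    · subst hy; simp [hx]
    · simp [hx, hy, this hx hy]

/-- Without loops, each half-edge at `v` belongs to an edge into `S` or to an edge away from both
`S` and `v`. Closedness ensures that no other edges cross `S` or `insert v S`. -/
theorem valence_eq_add {M : OrGraph k} (hl : M.Loopless) {v : Fin k} {S : Finset (Fin k)}
    (hv : v ∉ S) (hc : M.Closed v S) : M.valence v = M.cross S + M.cross (insert v S) := by
  induction M using Multiset.induction_on with
  | empty => simp [valence, cross]
  | cons e M ih =>
    obtain ⟨x, y⟩ := e
    have hxy : x ≠ y := by rintro rfl; exact hl x (Multiset.mem_cons_self _ _)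
    have h1 := hc.crosses_iff hv (Multiset.mem_cons_self (x, y) M)
    have h2 := hc.crosses_insert_iff (Multiset.mem_cons_self (x, y) M) hxy
    rw [valence_cons, cross_cons, cross_cons, ih (fun a h => hl a (Multiset.mem_cons_of_mem h))
      fun a b h => hc a b (Multiset.mem_cons_of_mem h)]
    simp only [h1, h2]
    by_cases hx : x = v
    · subst hx
      by_cases hy : y ∈ S <;> simp [hy, hxy.symm, hv] <;> omega
    · by_cases hy : y = v
      · subst hy
        by_cases hx' : x ∈ S <;> simp [hx', hx] <;> omega
      · simp [hx, hy]

theorem IsLobe.cross_insert_pos {M : OrGraph k} (hM : M.Admissible) {v : Fin k}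
    {S : Finset (Fin k)} (hS : M.IsLobe v S) : 0 < M.cross (insert v S) := by
  obtain ⟨b, hb, hbv⟩ := hS.exists_outside
  exact (connected_iff.1 hM.connected).2 _ ⟨v, by simp⟩ ⟨b, by simp [hb, hbv]⟩

theorem IsLobe.pullable_iff {M : OrGraph k} (hl : M.Loopless) {v : Fin k}
    {S : Finset (Fin k)} (hS : M.IsLobe v S) : M.Pullable (v, S) ↔ 2 ≤ M.cross (insert v S) := by
  change M.cross S + 2 ≤ M.valence v ↔ _
  rw [valence_eq_add hl hS.notMem hS.closed]
  omega

/-- Connectedness supplies at least one edge from `v` away from the lobe and the failure of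
pullability at most one. This edge is the stem of the lobe, and it is a bridge. -/
theorem IsLobe.cross_insert_eq_one {M : OrGraph k} (hM : M.Admissible) (hl : M.Loopless) {v : Fin k}
    {S : Finset (Fin k)} (hS : M.IsLobe v S) (hp : ¬ M.Pullable (v, S)) :
    M.cross (insert v S) = 1 := by
  have := hS.cross_insert_pos hM
  rw [hS.pullable_iff hl] at hp
  omega

/-- A bridge does not join a lobe to its cut vertex. -/
theorem IsLobe.not_crosses {M : OrGraph k} {v : Fin k} {S : Finset (Fin k)} (hS : M.IsLobe v S)
    {e : Fin k × Fin k} (he : e ∈ M) (hb : M.IsBridge e) : ¬ Crosses S e := by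
  intro hce
  obtain ⟨A, hA, hAe⟩ := hb
  have hends : ∀ f ∈ M, Crosses S f → ∃ u ∈ S, f = (u, v) ∨ f = (v, u) := by
    rintro ⟨x, y⟩ hf hcf
    rcases (hS.closed.crosses_iff hS.notMem hf).1 hcf with ⟨rfl, h⟩ | ⟨rfl, h⟩
    · exact ⟨y, h, Or.inr rfl⟩
    · exact ⟨x, h, Or.inl rfl⟩
  obtain ⟨u, huS, hu⟩ := hends e he hce
  have huA : ¬ (u ∈ A ↔ v ∈ A) := by
    rcases hu with rfl | rfl
    · exact hAe
    · exact crosses_swap.1 hAe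
  have htwo := hS.two_le
  rw [cross_erase_add he, if_pos hce] at htwo
  -- A lobe has a second edge to `v`. It does not cross `A`, so its end `w` in `S` is on the side of
  -- `v`, opposite to `u`.
  obtain ⟨f, hf, hcf⟩ := cross_pos.1 (show 0 < cross (M.erase e) S by omega)
  obtain ⟨w, hwS, hw⟩ := hends f (Multiset.mem_of_mem_erase hf) hcf
  have hwA : w ∈ A ↔ v ∈ A := by
    have := not_crosses_of_mem_erase hA he hAe hf
    rcases hw with rfl | rfl
    · exact not_not.1 this
    · exact (not_not.1 this).symm
  -- Only `e` crosses `A`, so the part of `S` on the side of `u` is closed. It is then all of `S`,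
  -- although it misses `w`.
  have hT := hS.eq_of_closed (S.filter fun x => x ∈ A ↔ u ∈ A) (Finset.filter_subset _ _)
    ⟨u, by simp [huS]⟩ (by
      intro x y hxy hx hy
      have hne : (x, y) ≠ e := by
        rintro rfl
        rcases hu with h | h <;> rw [Prod.mk.injEq] at h
        · exact hy h.2
        · exact hx h.1
      have h1 := not_not.1 (not_crosses_of_mem_erase hA he hAe ((Multiset.mem_erase_of_ne hne).2 hxy))
      simp only at h1
      simp only [Finset.mem_filter, hS.closed x y hxy hx hy, h1])
  have : w ∈ S.filter fun x => x ∈ A ↔ u ∈ A := hT.symm ▸ hwS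
  have := (Finset.mem_filter.1 this).2
  tauto

/-! ### Lobes under the collapse of a bridge -/

section Contract

variable {M : OrGraph (k + 1)} {j : Fin (k + 1)} {p : Fin k}

theorem mem_contract_of_mem {x y : Fin (k + 1)} (he : (x, y) ∈ M) (hne : merge j p x ≠ merge j p y) :
    (merge j p x, merge j p y) ∈ contract M j p := by
  refine mem_mapVertices ((Multiset.mem_erase_of_ne ?_).2 he)
  intro h
  rw [Prod.mk.injEq] at h
  rw [h.1, h.2, merge_same, merge_succAbove] at hne
  exact hne rfl

/-- A loop could only come from an edge parallel to the collapsed one, but that edge would cross the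
same set as the bridge. -/
theorem loopless_contract (hl : M.Loopless) (he : (j.succAbove p, j) ∈ M)
    (hb : M.IsBridge (j.succAbove p, j)) : (contract M j p).Loopless := by
  intro a ha
  obtain ⟨x, y, hxy, hx, hy⟩ := exists_of_mem_mapVertices ha
  have hne : x ≠ y := by rintro rfl; exact hl x (Multiset.mem_of_mem_erase hxy)
  obtain ⟨A, hA, hAe⟩ := hb
  have hn := not_crosses_of_mem_erase hA he hAe hxy
  rcases merge_eq_merge (hx.trans hy.symm) hne with ⟨rfl, rfl⟩ | ⟨rfl, rfl⟩
  · exact hn (crosses_swap.1 hAe)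
  · exact hn hAe

theorem merge_mem_pre_iff {x : Fin (k + 1)} {A : Finset (Fin (k + 1))}
    (h : ¬ Crosses A (j.succAbove p, j)) : merge j p x ∈ pre j.succAbove A ↔ x ∈ A := by
  conv_rhs => rw [eq_pre_of_saturated h]
  simp only [mem_pre]

theorem IsLobe.contract (hM : M.Admissible) (hl : M.Loopless) (he : (j.succAbove p, j) ∈ M)
    (hb : M.IsBridge (j.succAbove p, j)) {v : Fin (k + 1)} {T : Finset (Fin k)}
    (hS : M.IsLobe v (pre (merge j p) T)) : (M.contract j p).IsLobe (merge j p v) T := by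
  have hv : merge j p v ∉ T := fun h => hS.notMem (mem_pre.2 h)
  have hpre : ∀ T' T'' : Finset (Fin k), pre (merge j p) T' = pre (merge j p) T'' → T' = T'' := by
    intro T' T'' h
    ext x
    have := congrArg (fun A => j.succAbove x ∈ A) h
    simpa using this
  refine ⟨hv, ?_, ?_, ?_, ?_, ?_⟩
  · obtain ⟨x, hx⟩ := hS.nonempty
    exact ⟨_, mem_pre.1 hx⟩
  · obtain ⟨b, hbS, hbv⟩ := hS.exists_outside
    -- Here the outside vertex `b` is merged with `v`. By the valence condition it has a further
    -- neighbour `c`, which is not merged with it and lies outside the lobe, and so replaces it.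
    by_cases hq : merge j p b = merge j p v
    · have hval : 0 < valence (M.erase (j.succAbove p, j)) b := by
        have h3 := hM.three_le_valence b
        rw [← Multiset.cons_erase he, valence_cons] at h3
        split_ifs at h3 <;> omega
      have hl' := loopless_contract hl he hb
      obtain ⟨c, hc⟩ := exists_edge_of_valence_pos hval
      have hcb : merge j p c ≠ merge j p b := by
        intro h
        rcases hc with hc | hc
        · have := mem_mapVertices (f := merge j p) hc
          rw [h] at this
          exact hl' _ this
        · have := mem_mapVertices (f := merge j p) hc
          rw [h] at this
          exact hl' _ this
      have hcv : c ≠ v := by rintro rfl; exact hcb hq.symm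
      refine ⟨merge j p c, fun h => hbS ?_, fun h => hcb (h.trans hq.symm)⟩
      rcases hc with hc | hc
      · exact (hS.closed _ _ (Multiset.mem_of_mem_erase hc) hbv hcv).2 (mem_pre.2 h)
      · exact (hS.closed _ _ (Multiset.mem_of_mem_erase hc) hcv hbv).1 (mem_pre.2 h)
    · exact ⟨merge j p b, fun h => hbS (mem_pre.2 h), hq⟩
  · intro x y hxy hx hy
    obtain ⟨s, t, hst, rfl, rfl⟩ := exists_of_mem_mapVertices hxy
    rw [← mem_pre, ← mem_pre]
    exact hS.closed s t (Multiset.mem_of_mem_erase hst) (fun h => hx (by rw [h]))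
      (fun h => hy (by rw [h]))
  · rw [cross_contract he]; exact hS.two_le
  · intro T' hT' hne hc
    refine hpre _ _ (hS.eq_of_closed _ (fun x hx => mem_pre.2 (hT' (mem_pre.1 hx))) ?_ ?_)
    · obtain ⟨x, hx⟩ := hne
      exact ⟨j.succAbove x, by simpa using hx⟩
    · intro x y hxy hx hy
      rw [mem_pre, mem_pre]
      by_cases hq : merge j p x = merge j p y
      · rw [hq]
      have hcl := hS.closed x y hxy hx hy
      rw [mem_pre, mem_pre] at hcl
      -- If `x ≠ v` is merged with `v`, it lies outside the lobe, and so does its neighbour `y`;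
      -- both memberships are false.
      by_cases hqx : merge j p x = merge j p v
      · rw [hqx] at hcl ⊢
        exact ⟨fun h => absurd (hT' h) hv, fun h => absurd (hcl.2 (hT' h)) hv⟩
      · by_cases hqy : merge j p y = merge j p v
        · rw [hqy] at hcl ⊢
          exact ⟨fun h => absurd (hcl.1 (hT' h)) hv, fun h => absurd (hT' h) hv⟩
        · exact hc _ _ (mem_contract_of_mem hxy hq) hqx hqy

/-- Only the merged vertex leaves a choice for `v`. A lobe there is connected, so it lies on one
side of the bridge, and its cut vertex upstairs is the end of the bridge on that side. -/
theorem IsLobe.exists_of_contract (he : (j.succAbove p, j) ∈ M)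
    (hb : M.IsBridge (j.succAbove p, j)) {w : Fin k} {T : Finset (Fin k)}
    (hT : (M.contract j p).IsLobe w T) :
    ∃ v, merge j p v = w ∧ M.IsLobe v (pre (merge j p) T) := by
  obtain ⟨v, hvw, hcl⟩ : ∃ v, merge j p v = w ∧ M.Closed v (pre (merge j p) T) := by
    by_cases hw : w = p
    · subst hw
      obtain ⟨A, hA, hAe⟩ := hb
      have hedge : ∀ x y, (x, y) ∈ M → merge j w x ≠ merge j w y → (x ∈ A ↔ y ∈ A) := by
        intro x y hxy hne
        refine not_not.1 (not_crosses_of_mem_erase hA he hAe ((Multiset.mem_erase_of_ne ?_).2 hxy))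
        intro h
        rw [Prod.mk.injEq] at h
        rw [h.1, h.2, merge_same, merge_succAbove] at hne
        exact hne rfl
      obtain ⟨t, ht⟩ := hT.nonempty
      -- The part of `T` on the same side of `A` as `t` is closed, because only the collapsed edge
      -- crosses `A`; by minimality it is all of `T`.
      have hT' := hT.eq_of_closed (T.filter fun x => j.succAbove x ∈ A ↔ j.succAbove t ∈ A)
        (Finset.filter_subset _ _) ⟨t, by simp [ht]⟩ (by
          intro x y hxy hx hy
          have h1 := hT.closed x y hxy hx hy
          obtain ⟨a, b, hab, rfl, rfl⟩ := exists_of_mem_mapVertices hxy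
          have hsucc : ∀ c, merge j w c ≠ w → j.succAbove (merge j w c) = c := by
            intro c hc
            by_cases h : c = j
            · rw [h, merge_same] at hc; exact absurd rfl hc
            · obtain ⟨q, rfl⟩ := Fin.exists_succAbove_eq h
              rw [merge_succAbove]
          have h2 := not_not.1 (not_crosses_of_mem_erase hA he hAe hab)
          simp only at h2
          simp only [Finset.mem_filter, h1, hsucc a hx, hsucc b hy, h2])
      have hTA : ∀ x, merge j w x ∈ T → (x ∈ A ↔ j.succAbove t ∈ A) := by
        intro x hx
        rw [← hT'] at hx
        have hx' := Finset.mem_filter.1 hx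
        have hxj : x ≠ j := by
          rintro rfl
          rw [merge_same] at hx'
          exact hT.notMem hx'.1
        obtain ⟨q, rfl⟩ := Fin.exists_succAbove_eq hxj
        simpa using hx'.2
      -- The bridge crosses `A`, so exactly one of its ends is on the side of the lobe.
      obtain ⟨v, hvw, hvA⟩ : ∃ v, merge j w v = w ∧ (v ∈ A ↔ j.succAbove t ∈ A) := by
        by_cases hj : j ∈ A ↔ j.succAbove t ∈ A
        · exact ⟨j, merge_same _ _, hj⟩
        · refine ⟨j.succAbove w, merge_succAbove _ _ _, ?_⟩
          simp only [Crosses] at hAe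
          tauto
      have huniq : ∀ x, merge j w x = w → (x ∈ A ↔ j.succAbove t ∈ A) → x = v := by
        intro x hx hxA
        by_contra hne
        simp only [Crosses] at hAe
        rcases merge_eq_merge (hx.trans hvw.symm) hne with ⟨rfl, rfl⟩ | ⟨rfl, rfl⟩ <;> tauto
      have hone : ∀ x y, ((x, y) ∈ M ∨ (y, x) ∈ M) → x ≠ v → merge j w x ∈ T → y ≠ v →
          merge j w y ∈ T := by
        intro x y hxy hx hxT hy
        by_cases hq : merge j w x = merge j w y
        · rwa [← hq]
        have hxw : merge j w x ≠ w := fun h => hT.notMem (h ▸ hxT)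
        have hyw : merge j w y ≠ w := by
          intro h
          refine hy (huniq y h ?_)
          rw [← hTA x hxT]
          rcases hxy with hxy | hxy
          · exact (hedge x y hxy hq).symm
          · exact hedge y x hxy (Ne.symm hq)
        rcases hxy with hxy | hxy
        · exact (hT.closed _ _ (mem_contract_of_mem hxy hq) hxw hyw).1 hxT
        · exact (hT.closed _ _ (mem_contract_of_mem hxy (Ne.symm hq)) hyw hxw).2 hxT
      refine ⟨v, hvw, fun x y hxy hx hy => ?_⟩
      rw [mem_pre, mem_pre]
      exact ⟨fun h => hone x y (Or.inl hxy) hx h hy, fun h => hone y x (Or.inr hxy) hy h hx⟩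
    · refine ⟨j.succAbove w, merge_succAbove _ _ _, fun x y hxy hx hy => ?_⟩
      have huniq : ∀ x, x ≠ j.succAbove w → merge j p x ≠ w := by
        intro x hx h
        rw [← merge_succAbove j p w] at h
        rcases merge_eq_merge h hx with ⟨_, h⟩ | ⟨_, h⟩
        · exact hw (Fin.succAbove_right_injective h)
        · exact Fin.succAbove_ne _ _ h
      rw [mem_pre, mem_pre]
      by_cases hq : merge j p x = merge j p y
      · rw [hq]
      · exact hT.closed _ _ (mem_contract_of_mem hxy hq) (huniq x hx) (huniq y hy)
  refine ⟨v, hvw, ?_, ?_, ?_, hcl, ?_, ?_⟩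
  · rw [mem_pre, hvw]; exact hT.notMem
  · obtain ⟨x, hx⟩ := hT.nonempty
    exact ⟨j.succAbove x, by simpa using hx⟩
  · obtain ⟨b, hbT, hbw⟩ := hT.exists_outside
    refine ⟨j.succAbove b, by simpa using hbT, ?_⟩
    rintro rfl
    rw [merge_succAbove] at hvw
    exact hbw hvw
  · rw [← cross_contract he]; exact hT.two_le
  · intro S' hS' hne hc
    -- If `p ∈ T`, both ends of the bridge differ from `v`, and closedness of `S'` applies to the
    -- bridge; otherwise neither end is in `S'`.
    have hsat : ¬ Crosses S' (j.succAbove p, j) := by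
      have hends : j ∈ S' ∨ j.succAbove p ∈ S' → p ∈ T := by
        rintro (h | h)
        · simpa using hS' h
        · simpa using hS' h
      by_cases hp : p ∈ T
      · have hvp : merge j p v ≠ p := by rw [hvw]; rintro rfl; exact hT.notMem hp
        refine not_not.2 (hc _ _ he ?_ ?_)
        · rintro rfl; simp at hvp
        · rintro rfl; simp at hvp
      · have h1 : j ∉ S' := fun h => hp (hends (Or.inl h))
        have h2 : j.succAbove p ∉ S' := fun h => hp (hends (Or.inr h))
        simp [Crosses, h1, h2]
    have hpre := eq_pre_of_saturated hsat
    rw [hpre]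
    congr 1
    refine hT.eq_of_closed _ (fun x hx => ?_) ?_ ?_
    · simpa using hS' (mem_pre.1 hx)
    · obtain ⟨x, hx⟩ := hne
      exact ⟨merge j p x, (merge_mem_pre_iff hsat).2 hx⟩
    · intro x y hxy hx hy
      obtain ⟨s, t, hst, rfl, rfl⟩ := exists_of_mem_mapVertices hxy
      rw [merge_mem_pre_iff hsat, merge_mem_pre_iff hsat]
      exact hc s t (Multiset.mem_of_mem_erase hst) (fun h => hx (by rw [h, hvw]))
        (fun h => hy (by rw [h, hvw]))

/-- Some edge crosses `S`, and its end outside `S` must be the cut vertex. -/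
theorem IsLobe.vertex_unique {M : OrGraph k} {v w : Fin k} {S : Finset (Fin k)}
    (h : M.IsLobe v S) (h' : M.IsLobe w S) : v = w := by
  obtain ⟨⟨x, y⟩, he, hc⟩ := cross_pos.1 (lt_of_lt_of_le two_pos h.two_le)
  have h1 := (h.closed.crosses_iff h.notMem he).1 hc
  have h2 := (h'.closed.crosses_iff h'.notMem he).1 hc
  rcases h1 with ⟨rfl, h1⟩ | ⟨rfl, h1⟩ <;> rcases h2 with ⟨rfl, h2⟩ | ⟨rfl, h2⟩
  · rfl
  · exact absurd h2 h.notMem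
  · exact absurd h2 h.notMem
  · rfl

/-- The map from the lobes of a graph to the lobes of the graph in which a bridge is collapsed. -/
def contractPair (j : Fin (k + 1)) (p : Fin k) (x : Fin (k + 1) × Finset (Fin (k + 1))) :
    Fin k × Finset (Fin k) :=
  (merge j p x.1, pre j.succAbove x.2)

theorem lobes_contract (hM : M.Admissible) (hl : M.Loopless) (he : (j.succAbove p, j) ∈ M)
    (hb : M.IsBridge (j.succAbove p, j)) :
    (M.contract j p).lobes = M.lobes.image (contractPair j p) := by
  ext ⟨w, T⟩
  rw [Finset.mem_image, mem_lobes]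
  constructor
  · intro h
    obtain ⟨v, hv, hS⟩ := h.exists_of_contract he hb
    refine ⟨(v, pre (merge j p) T), mem_lobes.2 hS, ?_⟩
    rw [contractPair, hv, Prod.mk.injEq]
    refine ⟨rfl, ?_⟩
    ext x; simp
  · rintro ⟨⟨v, S⟩, hS, hx⟩
    rw [mem_lobes] at hS
    have hsat := eq_pre_of_saturated (hS.not_crosses he hb)
    rw [hsat] at hS
    rw [contractPair, Prod.mk.injEq] at hx
    rw [← hx.1, ← hx.2]
    exact hS.contract hM hl he hb

/-- The set of a lobe is recovered from its image because a bridge does not cross it, and the set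
determines the vertex. With `lobes_contract` this gives equal numbers of lobes, hence equal
averaging factors. -/
theorem contractPair_injOn (he : (j.succAbove p, j) ∈ M) (hb : M.IsBridge (j.succAbove p, j)) :
    Set.InjOn (contractPair j p) (M.lobes : Set (Fin (k + 1) × Finset (Fin (k + 1)))) := by
  rintro ⟨v, S⟩ hS ⟨v', S'⟩ hS' h
  rw [Finset.mem_coe, mem_lobes] at hS hS'
  rw [contractPair, contractPair, Prod.mk.injEq] at h
  simp only at hS hS'
  have hSS : S = S' := by
    rw [eq_pre_of_saturated (hS.not_crosses he hb), eq_pre_of_saturated (hS'.not_crosses he hb)]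
    congr 1
    exact h.2
  subst hSS
  rw [hS.vertex_unique hS']

end Contract

end OrGraph

/-! ### The homotopy operator and the collapse of a single edge -/

section Homotopy

variable {K : Type*} [Field K] {k : ℕ}

theorem merge_castSucc (j : Fin (k + 1)) (p : Fin k) (x : Fin (k + 1)) :
    merge j.castSucc p.castSucc x.castSucc = (merge j p x).castSucc := by
  by_cases hx : x = j
  · rw [hx, merge_same, merge_same]
  · obtain ⟨q, rfl⟩ := Fin.exists_succAbove_eq hx
    rw [← Fin.castSucc_succAbove_castSucc, merge_succAbove, merge_succAbove]

theorem merge_castSucc_last (j : Fin (k + 1)) (p : Fin k) :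
    merge j.castSucc p.castSucc (Fin.last (k + 1)) = Fin.last k := by
  have h : (j.castSucc).succAbove (Fin.last k) = Fin.last (k + 1) := by
    rw [Fin.succAbove_of_lt_succ]
    · rfl
    · exact Fin.castSucc_lt_last j
  rw [← h, merge_succAbove]

/-- The ends to be redirected are the same before and after merging: by closedness, an end merged
with `v` whose neighbour lies in the lobe is `v` itself. This makes pulling commute with merging. -/
theorem merge_and_mem_iff {R : OrGraph (k + 1)} {j : Fin (k + 1)} {p : Fin k} {v : Fin (k + 1)}
    {T : Finset (Fin k)} (hv : merge j p v ∉ T) (hc : R.Closed v (pre (merge j p) T))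
    {x y : Fin (k + 1)} (he : (x, y) ∈ R ∨ (y, x) ∈ R) :
    (merge j p x = merge j p v ∧ merge j p y ∈ T) ↔ (x = v ∧ y ∈ pre (merge j p) T) := by
  rw [mem_pre]
  refine ⟨fun ⟨h1, h2⟩ => ⟨?_, h2⟩, fun ⟨h1, h2⟩ => ⟨by rw [h1], h2⟩⟩
  by_contra hx
  have hy : y ≠ v := by rintro rfl; exact hv h2
  have hiff : x ∈ pre (merge j p) T ↔ y ∈ pre (merge j p) T := by
    rcases he with he | he
    · exact hc x y he hx hy
    · exact (hc y x he hy hx).symm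
  rw [mem_pre, mem_pre, h1] at hiff
  exact hv (hiff.2 h2)

theorem mapVertices_merge_pull {R : OrGraph (k + 1)} {j : Fin (k + 1)} {p : Fin k}
    {v : Fin (k + 1)} {T : Finset (Fin k)} (hv : merge j p v ∉ T)
    (hc : R.Closed v (pre (merge j p) T)) :
    mapVertices (merge j.castSucc p.castSucc) (pull R v (pre (merge j p) T))
      = pull (mapVertices (merge j p) R) (merge j p v) T := by
  rw [pull, pull, mapVertices_cons, merge_castSucc, merge_castSucc_last]
  congr 1
  rw [mapVertices, mapVertices, Multiset.map_map, Multiset.map_map]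
  refine Multiset.map_congr rfl fun e he => ?_
  obtain ⟨x, y⟩ := e
  simp only [Function.comp_apply, redirect, Prod.map_apply,
    merge_and_mem_iff hv hc (Or.inl he), merge_and_mem_iff hv hc (Or.inr he),
    apply_ite (merge j.castSucc p.castSucc), merge_castSucc, merge_castSucc_last]

/-- Collapsing a bridge after pulling off a lobe. -/
theorem collapse_pull_bridge {M : OrGraph (k + 1)} {j : Fin (k + 1)} {p : Fin k}
    (he : (j.succAbove p, j) ∈ M) {v : Fin (k + 1)} {T : Finset (Fin k)}
    (hv : merge j p v ∉ T) (hc : M.Closed v (pre (merge j p) T)) :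
    collapse K (pull M v (pre (merge j p) T)) (redirect v (pre (merge j p) T) (j.succAbove p, j))
      = (-1 : K) ^ (j : ℕ) • cls K (pull (contract M j p) (merge j p v) T) := by
  -- The collapsed edge is not redirected: an end at `v` and the other in the preimage of `T` would
  -- give `merge j p v ∈ T`.
  have hr : redirect v (pre (merge j p) T) (j.succAbove p, j)
      = (j.castSucc.succAbove p.castSucc, j.castSucc) := by
    rw [Fin.castSucc_succAbove_castSucc, redirect]
    rw [if_neg, if_neg]
    · rintro ⟨rfl, h⟩
      simp at h hv
      exact hv h
    · rintro ⟨rfl, h⟩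
      simp at h hv
      exact hv h
  have herase := pull_erase he v (pre (merge j p) T)
  rw [hr] at herase ⊢
  rw [collapse_edge, herase, mapVertices_merge_pull hv fun x y h =>
    hc x y (Multiset.mem_of_mem_erase h)]
  rfl

/-- If the only edge from `v` that does not lead to the lobe at `v` is collapsed, then pulling the lobe
off the merged vertex gives back the original graph up to the names of the vertices. -/
theorem map_redirect_eq_mapVertices {R : OrGraph (k + 1)} {j : Fin (k + 1)} {p : Fin k}
    {v : Fin (k + 1)} {T : Finset (Fin k)} (hv : merge j p v ∉ T)
    (hc : R.Closed v (pre (merge j p) T)) (hl : R.Loopless)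
    (hR : R.cross (insert v (pre (merge j p) T)) = 0)
    (σ : Fin (k + 1) → Fin (k + 1)) (hσv : σ v = Fin.last k)
    (hσ : ∀ x, x ≠ v → σ x = (merge j p x).castSucc) :
    Multiset.map (redirect (merge j p v) T) (mapVertices (merge j p) R) = mapVertices σ R := by
  rw [mapVertices, mapVertices, Multiset.map_map]
  refine Multiset.map_congr rfl fun e he => ?_
  obtain ⟨x, y⟩ := e
  have hxy : x ≠ y := by rintro rfl; exact hl x he
  have hout : ¬ ((x = v ∧ y ∉ pre (merge j p) T) ∨ (y = v ∧ x ∉ pre (merge j p) T)) := by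
    rw [← hc.crosses_insert_iff he hxy]
    intro h
    have : 0 < R.cross (insert v (pre (merge j p) T)) := cross_pos.2 ⟨_, he, h⟩
    omega
  simp only [Function.comp_apply, redirect, Prod.map_apply,
    merge_and_mem_iff hv hc (Or.inl he), merge_and_mem_iff hv hc (Or.inr he), Prod.mk.injEq]
  constructor
  · by_cases hx : x = v
    · rw [if_pos ⟨hx, by tauto⟩, hx, hσv]
    · rw [if_neg (by tauto), hσ x hx]
  · by_cases hy : y = v
    · rw [if_pos ⟨hy, by tauto⟩, hy, hσv]
    · rw [if_neg (by tauto), hσ y hy]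

/-- There is a permutation that makes the vertex `j` the last one and keeps the order of the others. -/
theorem exists_perm_last (j : Fin (k + 1)) : ∃ σ : Equiv.Perm (Fin (k + 1)), σ j = Fin.last k ∧
    (∀ x, σ (j.succAbove x) = x.castSucc) ∧
      (Equiv.Perm.sign σ : ℤ) = (-1) ^ k * (-1) ^ (j : ℕ) := by
  refine ⟨(Fin.cycleRange (Fin.last k))⁻¹ * Fin.cycleRange j, ?_, fun x => ?_, ?_⟩
  · rw [Equiv.Perm.mul_apply, Equiv.Perm.inv_eq_iff_eq, Fin.cycleRange_self, Fin.cycleRange_self]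
  · rw [Equiv.Perm.mul_apply, Equiv.Perm.inv_eq_iff_eq, Fin.cycleRange_succAbove,
      ← Fin.succAbove_last_apply, Fin.cycleRange_succAbove]
  · simp [Equiv.Perm.sign_mul, Equiv.Perm.sign_inv, Fin.sign_cycleRange]

/-- The collapsed edge is the stem, and pulling the lobe off the merged vertex recreates it with `v`
as the last vertex. If `v = j`, the sign is that of moving `j` to the end. If `v` is the source, an
additional transposition and the reversal of the stem contribute two signs that cancel. -/
theorem cls_pull_contract {M : OrGraph (k + 1)} (hl : M.Loopless) {j : Fin (k + 1)} {p : Fin k}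
    (he : (j.succAbove p, j) ∈ M) {v : Fin (k + 1)} {T : Finset (Fin k)}
    (hv : merge j p v ∉ T) (hc : M.Closed v (pre (merge j p) T))
    (hone : M.cross (insert v (pre (merge j p) T)) = 1)
    (hcr : Crosses (insert v (pre (merge j p) T)) (j.succAbove p, j)) :
    cls K (pull (contract M j p) (merge j p v) T)
      = ((-1 : K) ^ k * (-1) ^ (j : ℕ)) • cls K M := by
  obtain ⟨σ, hσj, hσ, hs⟩ := exists_perm_last j
  have hs' : ((Equiv.Perm.sign σ : ℤ) : K) = (-1) ^ k * (-1) ^ (j : ℕ) := by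
    rw [hs]; push_cast; rfl
  have hcR : OrGraph.Closed (M.erase (j.succAbove p, j)) v (pre (merge j p) T) := fun x y h =>
    hc x y (Multiset.mem_of_mem_erase h)
  have hlR : OrGraph.Loopless (M.erase (j.succAbove p, j)) := fun a h =>
    hl a (Multiset.mem_of_mem_erase h)
  have hR : cross (M.erase (j.succAbove p, j)) (insert v (pre (merge j p) T)) = 0 := by
    have h := cross_erase_add he (insert v (pre (merge j p) T))
    rw [if_pos hcr] at h
    omega
  have hne := Fin.succAbove_ne j p
  have hvp : merge j p v = p ∧ (v = j ∨ v = j.succAbove p) := by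
    rcases (hc.crosses_insert_iff he hne).1 hcr with ⟨h, _⟩ | ⟨h, _⟩
    · rw [← h]; simp
    · rw [← h]; simp
  obtain ⟨hqv, rfl | rfl⟩ := hvp
  · rw [pull, OrGraph.contract, map_redirect_eq_mapVertices hv hcR hlR hR σ hσj ?_, merge_same]
    · have : (p.castSucc, Fin.last k) ::ₘ mapVertices σ (M.erase (v.succAbove p, v))
          = mapVertices σ M := by
        conv_rhs => rw [← Multiset.cons_erase he]
        rw [mapVertices_cons, hσj, hσ]
      rw [this, cls_mapVertices, hs']
    · intro x hx
      obtain ⟨q, rfl⟩ := Fin.exists_succAbove_eq hx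
      rw [hσ, merge_succAbove]
  · obtain ⟨τ, hτ⟩ : ∃ τ : Equiv.Perm (Fin (k + 1)), τ = σ * Equiv.swap j (j.succAbove p) := ⟨_, rfl⟩
    have hτp : τ (j.succAbove p) = Fin.last k := by
      rw [hτ, Equiv.Perm.mul_apply, Equiv.swap_apply_right, hσj]
    have hτj : τ j = p.castSucc := by
      rw [hτ, Equiv.Perm.mul_apply, Equiv.swap_apply_left, hσ]
    rw [pull, OrGraph.contract,
      map_redirect_eq_mapVertices hv hcR hlR hR τ hτp ?_,
      merge_succAbove]
    · have : (Fin.last k, p.castSucc) ::ₘ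
          mapVertices τ (M.erase (j.succAbove p, j))
          = mapVertices τ M := by
        conv_rhs => rw [← Multiset.cons_erase he]
        rw [mapVertices_cons, hτp, hτj]
      rw [cls_flip, this, cls_mapVertices, hτ, Equiv.Perm.sign_mul, Equiv.Perm.sign_swap hne.symm,
        ← hs', ← neg_smul]
      congr 1
      push_cast
      ring
    · intro x hx
      by_cases hxj : x = j
      · rw [hxj, hτj, merge_same]
      · obtain ⟨q, rfl⟩ := Fin.exists_succAbove_eq hxj
        rw [hτ, Equiv.Perm.mul_apply, Equiv.swap_apply_of_ne_of_ne hxj hx, hσ, merge_succAbove]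

variable (K) in
/-- The contribution of the lobe `x` and the edge `e` to the boundary of the homotopy operator. -/
def collapsePullTerm (M : OrGraph (k + 1)) (x : Fin (k + 1) × Finset (Fin (k + 1)))
    (e : Fin (k + 1) × Fin (k + 1)) : GraphSpace K (k + 1) :=
  if M.Pullable x then
    (-1 : K) ^ (k + 1) • collapse K (pull M x.1 x.2) (redirect x.1 x.2 e) else 0

variable (K) in
/-- The graph `M` if `x` cannot be pulled off and `e` is the edge that joins it to the other part of
the graph. -/
def stemTerm (M : OrGraph (k + 1)) (x : Fin (k + 1) × Finset (Fin (k + 1)))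
    (e : Fin (k + 1) × Fin (k + 1)) : GraphSpace K (k + 1) :=
  if ¬ M.Pullable x ∧ Crosses (insert x.1 x.2) e then cls K M else 0

theorem boundary_pullTerm (M : OrGraph (k + 1)) (x : Fin (k + 1) × Finset (Fin (k + 1))) :
    boundary K (k + 1) (pullTerm K M x) =
      (if M.Pullable x then cls K M else 0) + (Multiset.map (collapsePullTerm K M x) M).sum := by
  unfold pullTerm collapsePullTerm
  split_ifs with h
  · rw [map_smul, boundary_cls, boundaryGraph_pull, smul_add, smul_smul, Multiset.smul_sum,
      Multiset.map_map, ← mul_pow]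
    simp
  · simp

/-- A vertex off the collapsed edge keeps its valence. If the edge leads from `v` away from the
lobe, its other end has valence at least `3` and passes at least two half-edges to the merged
vertex, which makes the lobe pullable. -/
theorem pullable_contract_iff {M : OrGraph (k + 1)} (hM : M.Admissible) (hl : M.Loopless)
    {j : Fin (k + 1)} {p : Fin k} (he : (j.succAbove p, j) ∈ M)
    {v : Fin (k + 1)} {T : Finset (Fin k)} (hS : M.IsLobe v (pre (merge j p) T)) :
    (contract M j p).Pullable (merge j p v, T) ↔ M.Pullable (v, pre (merge j p) T) ∨
      Crosses (insert v (pre (merge j p) T)) (j.succAbove p, j) := by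
  have hne := Fin.succAbove_ne j p
  have hc := hS.closed.crosses_insert_iff he hne
  have hv : merge j p v ∉ T := fun h => hS.notMem (mem_pre.2 h)
  have hval := valence_eq_add hl hS.notMem hS.closed
  have hpos := hS.cross_insert_pos hM
  change cross (contract M j p) T + 2 ≤ valence (contract M j p) (merge j p v) ↔
    M.cross (pre (merge j p) T) + 2 ≤ M.valence v ∨ _
  rw [cross_contract he]
  have h1 := valence_merge j p (M.erase (j.succAbove p, j)) (merge j p v)
  change valence (contract M j p) (merge j p v) = _ at h1
  have h2 : ∀ u, valence M u = valence (M.erase (j.succAbove p, j)) u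
      + ((if j.succAbove p = u then 1 else 0) + (if j = u then 1 else 0)) := by
    intro u
    conv_lhs => rw [← Multiset.cons_erase he]
    rw [valence_cons]
  have hj := h2 j
  have hp := h2 (j.succAbove p)
  have h3j := hM.three_le_valence j
  have h3p := hM.three_le_valence (j.succAbove p)
  simp only [if_true, Fin.succAbove_ne, Fin.ne_succAbove, if_false] at hj hp
  by_cases hvj : v = j
  · subst hvj
    have : Crosses (insert v (pre (merge v p) T)) (v.succAbove p, v) := by
      rw [hc]; right; simpa using hv
    simp only [this, or_true, iff_true]
    rw [merge_same] at h1
    simp only [if_true] at h1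
    rw [merge_same]
    omega
  · by_cases hvp : v = j.succAbove p
    · subst hvp
      have : Crosses (insert (j.succAbove p) (pre (merge j p) T)) (j.succAbove p, j) := by
        rw [hc]; left; simpa using hv
      simp only [this, or_true, iff_true]
      rw [merge_succAbove] at h1
      simp only [if_true] at h1
      rw [merge_succAbove]
      omega
    · have : ¬ Crosses (insert v (pre (merge j p) T)) (j.succAbove p, j) := by
        rw [hc]
        rintro (⟨h, _⟩ | ⟨h, _⟩)
        · exact hvp h.symm
        · exact hvj h.symm
      simp only [this, or_false]
      obtain ⟨q, rfl⟩ := Fin.exists_succAbove_eq hvj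
      have hqp : q ≠ p := fun h => hvp (by rw [h])
      have hq := h2 (j.succAbove q)
      simp only [Fin.succAbove_right_inj, Fin.ne_succAbove, if_false, hqp.symm] at hq
      rw [merge_succAbove, if_neg hqp] at h1
      rw [merge_succAbove]
      omega

/-- For a bridge, the contributions of a lobe to `∂ h` and to `h ∂` cancel up to the graph itself. -/
theorem collapsePullTerm_add {M : OrGraph (k + 1)} (hM : M.Admissible) (hl : M.Loopless)
    {j : Fin (k + 1)} {p : Fin k} (he : (j.succAbove p, j) ∈ M)
    (hb : M.IsBridge (j.succAbove p, j)) {x : Fin (k + 1) × Finset (Fin (k + 1))}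
    (hx : x ∈ M.lobes) : collapsePullTerm K M x (j.succAbove p, j)
      + (-1 : K) ^ (j : ℕ) • pullTerm K (contract M j p) (contractPair j p x)
      = stemTerm K M x (j.succAbove p, j) := by
  obtain ⟨v, S⟩ := x
  have hS : M.IsLobe v S := mem_lobes.1 hx
  obtain ⟨T, rfl⟩ : ∃ T, S = pre (merge j p) T := ⟨_, eq_pre_of_saturated (hS.not_crosses he hb)⟩
  have hT : contractPair j p (v, pre (merge j p) T) = (merge j p v, T) := by
    rw [contractPair, Prod.mk.injEq]
    refine ⟨rfl, ?_⟩
    ext x; simp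
  have hv : merge j p v ∉ T := fun h => hS.notMem (mem_pre.2 h)
  have hiff := pullable_contract_iff hM hl he hS
  have hsq : ∀ n : ℕ, (-1 : K) ^ n * (-1) ^ n = 1 := fun n => by rw [← mul_pow]; simp
  rw [hT, pullTerm, collapsePullTerm, stemTerm]
  -- For a pullable lobe both orders of pulling and collapsing give the same graph, with signs `(-1)
  -- ^ (k + 1)` and `(-1) ^ k` that cancel.
  by_cases hp : M.Pullable (v, pre (merge j p) T)
  · rw [if_pos hp, if_pos (hiff.2 (Or.inl hp)), if_neg (fun h => h.1 hp),
      collapse_pull_bridge he hv hS.closed, smul_smul, smul_smul, ← add_smul]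
    convert zero_smul K _ using 2
    ring
  · rw [if_neg hp, zero_add]
    -- Otherwise the lobe becomes pullable precisely when its stem is collapsed, and pulling it then
    -- restores `M`.
    by_cases hc : Crosses (insert v (pre (merge j p) T)) (j.succAbove p, j)
    · rw [if_pos (hiff.2 (Or.inr hc)), if_pos ⟨hp, hc⟩, cls_pull_contract hl he hv hS.closed
        (hS.cross_insert_eq_one hM hl hp) hc, smul_smul, smul_smul]
      convert one_smul K _ using 2
      linear_combination (hsq j) * (-1) ^ k * (-1) ^ k + hsq k
    · rw [if_neg (fun h => (hiff.1 h).elim hp hc), if_neg (fun h => hc h.2), smul_zero]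

end Homotopy

/-! ### The filtration by the number of sets that are separated by one edge -/

section Filtration

variable (K : Type*) [Field K] (k : ℕ)

/-- The space spanned by the loopless graphs with a cut vertex in which at least `n` sets of vertices
are separated from the other vertices by exactly one edge. -/
def oneCutFiltration (n : ℕ) : Submodule K (GraphSpace K k) :=
  Submodule.span K {x | ∃ M : OrGraph k, Admissible M ∧ (∃ v, M.IsCutVertex v) ∧ M.Loopless ∧
    n ≤ M.oneCuts.card ∧ x = cls K M}

variable {K k}

theorem oneCutFiltration_anti {m n : ℕ} (h : m ≤ n) :
    oneCutFiltration K k n ≤ oneCutFiltration K k m :=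
  Submodule.span_mono fun _ ⟨M, h1, h2, h3, h4, h5⟩ => ⟨M, h1, h2, h3, h.trans h4, h5⟩

/-- Restricting the filtration to loopless graphs loses nothing, as graphs with a loop are zero in
characteristic `0`. -/
theorem cutSpan_le_oneCutFiltration [CharZero K] : cutSpan K k ≤ oneCutFiltration K k 0 := by
  refine Submodule.span_le.2 ?_
  rintro _ ⟨M, hM, hc, rfl⟩
  by_cases hl : M.Loopless
  · exact Submodule.subset_span ⟨M, hM, hc, hl, Nat.zero_le _, rfl⟩
  · simp only [Loopless, not_forall, not_not] at hl
    obtain ⟨a, ha⟩ := hl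
    rw [SetLike.mem_coe, cls_eq_zero_of_loop ha]
    exact zero_mem _

theorem oneCutFiltration_le_cutSpan (n : ℕ) : oneCutFiltration K k n ≤ cutSpan K k :=
  Submodule.span_mono fun _ ⟨M, h1, h2, _, _, h5⟩ => ⟨M, h1, h2, h5⟩

theorem oneCutFiltration_eq_bot {n : ℕ} (hn : 2 ^ k < n) : oneCutFiltration K k n = ⊥ := by
  rw [oneCutFiltration, Submodule.span_eq_bot]
  rintro _ ⟨M, _, _, _, h, _⟩
  have := Finset.card_le_univ M.oneCuts
  rw [Fintype.card_finset, Fintype.card_fin] at this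
  omega

theorem pullTerm_mem {M : OrGraph k} (hM : M.Admissible) (hl : M.Loopless)
    {x : Fin k × Finset (Fin k)} (hx : x ∈ M.lobes) :
    pullTerm K M x ∈ oneCutFiltration K (k + 1) (M.oneCuts.card + 1) := by
  have hS := mem_lobes.1 hx
  rw [pullTerm]
  split_ifs with hp
  · exact Submodule.smul_mem _ _ (Submodule.subset_span ⟨_, admissible_pull hM hS hp,
      ⟨_, isCutVertex_pull hS⟩, loopless_pull hl _ _, card_oneCuts_pull hS.notMem hS.closed, rfl⟩)
  · exact zero_mem _

theorem homotopyGraph_mem {M : OrGraph k} (hM : M.Admissible) (hl : M.Loopless) :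
    homotopyGraph K M ∈ oneCutFiltration K (k + 1) (M.oneCuts.card + 1) :=
  Submodule.smul_mem _ _ (Submodule.sum_mem _ fun _ hx => pullTerm_mem hM hl hx)

/-- If a loop is created the class is zero. Otherwise a cut vertex survives and no cut is lost. -/
theorem collapse_mem [CharZero K] {M : OrGraph (k + 1)} (hM : M.Admissible)
    (hc : ∃ v, M.IsCutVertex v) {e : Fin (k + 1) × Fin (k + 1)} (he : e ∈ M)
    (hb : ¬ M.IsBridge e) : collapse K M e ∈ oneCutFiltration K k M.oneCuts.card := by
  obtain ⟨v, hv⟩ := hc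
  rcases edge_cases e with ⟨j, rfl⟩ | ⟨j, p, rfl⟩
  · rw [collapse_loop]; exact zero_mem _
  · rw [collapse_eq_contract]
    refine Submodule.smul_mem _ _ ?_
    by_cases hl : (contract M j p).Loopless
    · exact Submodule.subset_span ⟨_, admissible_collapse hM he, exists_isCutVertex_collapse hM hv he hl,
        hl, card_oneCuts_contract he hb, rfl⟩
    · simp only [Loopless, not_forall, not_not] at hl
      obtain ⟨a, ha⟩ := hl
      rw [cls_eq_zero_of_loop ha]
      exact zero_mem _

theorem homotopy_collapse_mem [CharZero K] {M : OrGraph (k + 1)} (hM : M.Admissible)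
    {e : Fin (k + 1) × Fin (k + 1)} (he : e ∈ M) (hb : ¬ M.IsBridge e) :
    homotopy K k (collapse K M e) ∈ oneCutFiltration K (k + 1) (M.oneCuts.card + 1) := by
  rcases edge_cases e with ⟨j, rfl⟩ | ⟨j, p, rfl⟩
  · rw [collapse_loop, map_zero]; exact zero_mem _
  · rw [collapse_eq_contract, map_smul, homotopy_cls]
    refine Submodule.smul_mem _ _ ?_
    by_cases hl : (contract M j p).Loopless
    · exact oneCutFiltration_anti (Nat.succ_le_succ (card_oneCuts_contract he hb))
        (homotopyGraph_mem (admissible_collapse hM he) hl)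
    · simp only [Loopless, not_forall, not_not] at hl
      obtain ⟨a, ha⟩ := hl
      rw [← homotopy_cls, cls_eq_zero_of_loop ha, map_zero]
      exact zero_mem _

/-- Pulling raises the number of cuts, and the redirected edge is still not a bridge, so its
collapse does not lower the number again. -/
theorem collapsePullTerm_mem [CharZero K] {M : OrGraph (k + 1)} (hM : M.Admissible)
    {x : Fin (k + 1) × Finset (Fin (k + 1))} (hx : x ∈ M.lobes)
    {e : Fin (k + 1) × Fin (k + 1)} (he : e ∈ M) (hb : ¬ M.IsBridge e) :
    collapsePullTerm K M x e ∈ oneCutFiltration K (k + 1) (M.oneCuts.card + 1) := by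
  have hS := mem_lobes.1 hx
  rw [collapsePullTerm]
  split_ifs with hp
  · refine Submodule.smul_mem _ _ (oneCutFiltration_anti (card_oneCuts_pull hS.notMem hS.closed)
      (collapse_mem (admissible_pull hM hS hp) ⟨_, isCutVertex_pull hS⟩ ?_
        fun h => hb (IsBridge.of_pull he h)))
    exact Multiset.mem_cons_of_mem (Multiset.mem_map_of_mem _ he)
  · exact zero_mem _

theorem sum_map_ite {α V : Type*} [AddCommMonoid V] (P : α → Prop) [DecidablePred P] (c : V)
    (m : Multiset α) : (Multiset.map (fun a => if P a then c else 0) m).sum = m.countP P • c := by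
  induction m using Multiset.induction_on with
  | empty => simp
  | cons a m ih =>
    rw [Multiset.map_cons, Multiset.sum_cons, ih, Multiset.countP_cons, add_smul, add_comm]
    split_ifs <;> simp

/-- Every lobe yields one copy of `M`: from the new edge if it can be pulled off, from its unique
stem otherwise. -/
theorem sum_stemTerm {M : OrGraph (k + 1)} (hM : M.Admissible) (hl : M.Loopless)
    {x : Fin (k + 1) × Finset (Fin (k + 1))} (hx : x ∈ M.lobes) :
    (if M.Pullable x then cls K M else 0) + (Multiset.map (stemTerm K M x) M).sum = cls K M := by
  have hS := mem_lobes.1 hx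
  unfold stemTerm
  by_cases hp : M.Pullable x
  · simp [hp]
  · have hone : Multiset.countP (Crosses (insert x.1 x.2)) M = 1 := hS.cross_insert_eq_one hM hl hp
    simp only [hp, if_false, not_false_eq_true, true_and, zero_add]
    rw [sum_map_ite, hone, one_smul]

/-- The part of `∂ h + h ∂` that belongs to the edge `e`. -/
theorem edge_mem [CharZero K] {M : OrGraph (k + 1)} (hM : M.Admissible) (hl : M.Loopless)
    {e : Fin (k + 1) × Fin (k + 1)} (he : e ∈ M) :
    (M.lobes.card : K)⁻¹ • ∑ x ∈ M.lobes, (collapsePullTerm K M x e - stemTerm K M x e)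
      + homotopy K k (collapse K M e) ∈ oneCutFiltration K (k + 1) (M.oneCuts.card + 1) := by
  by_cases hb : M.IsBridge e
  -- For a bridge the expression vanishes exactly: the bijection of lobes aligns the two averages,
  -- and they agree term by term.
  · convert (oneCutFiltration K (k + 1) (M.oneCuts.card + 1)).zero_mem
    rcases edge_cases e with ⟨j, rfl⟩ | ⟨j, p, rfl⟩
    · exact absurd he (hl j)
    · rw [collapse_eq_contract, map_smul, homotopy_cls, homotopyGraph, lobes_contract hM hl he hb,
        Finset.card_image_of_injOn (contractPair_injOn he hb),
        Finset.sum_image (contractPair_injOn he hb), smul_comm, ← smul_add, Finset.smul_sum,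
        ← Finset.sum_add_distrib, Finset.sum_eq_zero, smul_zero]
      intro x hx
      rw [← collapsePullTerm_add hM hl he hb hx]
      abel
  · refine Submodule.add_mem _ (Submodule.smul_mem _ _ (Submodule.sum_mem _ fun x hx => ?_))
      (homotopy_collapse_mem hM he hb)
    -- A stem is a bridge, so it cannot be `e`.
    have hstem : stemTerm K M x e = 0 := by
      rw [stemTerm, if_neg]
      rintro ⟨hp, hc⟩
      exact hb ⟨_, (mem_lobes.1 hx).cross_insert_eq_one hM hl hp, hc⟩
    rw [hstem, sub_zero]
    exact collapsePullTerm_mem hM hx he hb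

/-- The homotopy operator contracts the complex of graphs with a cut vertex up to terms of higher
filtration. -/
theorem boundary_homotopyGraph_add [CharZero K] {M : OrGraph (k + 1)} (hM : M.Admissible)
    (hc : ∃ v, M.IsCutVertex v) (hl : M.Loopless) :
    boundary K (k + 1) (homotopyGraph K M) + homotopy K k (boundaryGraph K M) - cls K M
      ∈ oneCutFiltration K (k + 1) (M.oneCuts.card + 1) := by
  have hN : (M.lobes.card : K) ≠ 0 := by
    obtain ⟨v, hv⟩ := hc
    obtain ⟨w, S, hS⟩ := exists_isLobe hM hl hv
    rw [Nat.cast_ne_zero]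
    exact Finset.card_ne_zero_of_mem ((mem_lobes (x := (w, S))).2 hS)
  -- The class of `M` is written as the average of its copies, one for each lobe, so that it can be
  -- distributed over lobes and edges.
  have hcls : cls K M = (M.lobes.card : K)⁻¹ • ∑ x ∈ M.lobes,
      ((if M.Pullable x then cls K M else 0) + (Multiset.map (stemTerm K M x) M).sum) := by
    rw [Finset.sum_congr rfl fun x hx => sum_stemTerm hM hl hx, Finset.sum_const,
      ← Nat.cast_smul_eq_nsmul K, smul_smul, inv_mul_cancel₀ hN, one_smul]
  have hsum : boundary K (k + 1) (homotopyGraph K M) + homotopy K k (boundaryGraph K M) - cls K M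
      = (Multiset.map (fun e => (M.lobes.card : K)⁻¹ • ∑ x ∈ M.lobes,
        (collapsePullTerm K M x e - stemTerm K M x e) + homotopy K k (collapse K M e)) M).sum := by
    have hswap : (Multiset.map (fun e => ∑ x ∈ M.lobes,
        (collapsePullTerm K M x e - stemTerm K M x e)) M).sum = ∑ x ∈ M.lobes,
          ((Multiset.map (collapsePullTerm K M x) M).sum - (Multiset.map (stemTerm K M x) M).sum) := by
      simp only [← Multiset.sum_map_sub]
      exact Multiset.sum_map_sum_map M M.lobes.val
    have hbd : homotopy K k (boundaryGraph K M)
        = (Multiset.map (fun e => homotopy K k (collapse K M e)) M).sum := by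
      rw [boundaryGraph, map_multiset_sum, Multiset.map_map]; rfl
    have hsmul : ∀ f : Fin (k + 1) × Fin (k + 1) → GraphSpace K (k + 1),
        (Multiset.map (fun e => (M.lobes.card : K)⁻¹ • f e) M).sum
          = (M.lobes.card : K)⁻¹ • (Multiset.map f M).sum := by
      intro f
      rw [Multiset.smul_sum, Multiset.map_map]; rfl
    rw [Multiset.sum_map_add, hsmul, hswap, ← hbd, homotopyGraph, map_smul, map_sum]
    conv_lhs => rw [hcls]
    rw [add_sub_right_comm, ← smul_sub, ← Finset.sum_sub_distrib]
    congr 2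
    refine Finset.sum_congr rfl fun x _ => ?_
    rw [boundary_pullTerm]
    abel
  rw [hsum]
  refine multiset_sum_mem _ fun y hy => ?_
  obtain ⟨e, he, rfl⟩ := Multiset.mem_map.1 hy
  exact edge_mem hM hl he

/-- The witness is `h x`: on a cycle the term `h∂x` drops out of the homotopy formula, which extends
linearly from graphs. -/
theorem exists_boundary_sub_mem [CharZero K] {n : ℕ} {x : GraphSpace K (k + 1)}
    (hx : x ∈ oneCutFiltration K (k + 1) n) (hbx : boundary K k x = 0) :
    ∃ y ∈ cutSpan K (k + 2), x - boundary K (k + 1) y ∈ oneCutFiltration K (k + 1) (n + 1) := by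
  have key : ∀ x ∈ oneCutFiltration K (k + 1) n, homotopy K (k + 1) x ∈ cutSpan K (k + 2) ∧
      boundary K (k + 1) (homotopy K (k + 1) x) + homotopy K k (boundary K k x) - x
        ∈ oneCutFiltration K (k + 1) (n + 1) := by
    intro x hx
    induction hx using Submodule.span_induction with
    | mem x hx =>
      obtain ⟨M, hM, hc, hl, hn, rfl⟩ := hx
      rw [homotopy_cls, boundary_cls]
      exact ⟨oneCutFiltration_le_cutSpan _ (homotopyGraph_mem hM hl),
        oneCutFiltration_anti (Nat.succ_le_succ hn) (boundary_homotopyGraph_add hM hc hl)⟩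
    | zero => simp
    | add x y _ _ hx hy =>
      refine ⟨by rw [map_add]; exact add_mem hx.1 hy.1, ?_⟩
      convert add_mem hx.2 hy.2 using 1
      simp only [map_add]
      abel
    | smul a x _ hx =>
      refine ⟨by rw [map_smul]; exact Submodule.smul_mem _ _ hx.1, ?_⟩
      convert Submodule.smul_mem _ a hx.2 using 1
      simp only [map_smul, smul_sub, smul_add]
  obtain ⟨h1, h2⟩ := key x hx
  refine ⟨_, h1, ?_⟩
  rw [hbx, map_zero, add_zero] at h2
  rw [← neg_sub]
  exact neg_mem h2

/-- Every cycle of graphs with a cut vertex is a boundary of such graphs. -/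
theorem exists_boundary_eq [CharZero K] {x : GraphSpace K (k + 1)} (hx : x ∈ cutSpan K (k + 1))
    (hbx : boundary K k x = 0) : ∃ y ∈ cutSpan K (k + 2), boundary K (k + 1) y = x := by
  have key : ∀ n, ∃ y ∈ cutSpan K (k + 2),
      x - boundary K (k + 1) y ∈ oneCutFiltration K (k + 1) n := by
    intro n
    induction n with
    | zero => exact ⟨0, zero_mem _, by simpa using cutSpan_le_oneCutFiltration hx⟩
    | succ n ih =>
      obtain ⟨y, hy, hxy⟩ := ih
      obtain ⟨z, hz, hxz⟩ := exists_boundary_sub_mem hxy (by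
        rw [map_sub, hbx, boundary_boundary, sub_zero])
      refine ⟨y + z, add_mem hy hz, ?_⟩
      rwa [map_add, ← sub_sub]
  -- This step of the filtration exceeds the number `2 ^ (k + 1)` of sets of vertices, hence is
  -- zero.
  obtain ⟨y, hy, hxy⟩ := key (2 ^ (k + 1) + 1)
  rw [oneCutFiltration_eq_bot (Nat.lt_succ_self _), Submodule.mem_bot, sub_eq_zero] at hxy
  exact ⟨y, hy, hxy.symm⟩

/-- A connected graph has a vertex. This settles degree `0`, which `exists_boundary_eq` does not
cover. -/
theorem cutSpan_zero : cutSpan K 0 = ⊥ := by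
  rw [cutSpan, Submodule.span_eq_bot]
  rintro _ ⟨M, hM, _⟩
  exact hM.connected.nonempty.elim fun x => x.elim0

end Filtration

/-! ### Homology -/

section Homology

open CategoryTheory

universe u

variable (K : Type u) [Field K] [CharZero K]

theorem cutComplex_acyclic : (cutComplex K).Acyclic := by
  intro i
  cases i with
  | zero =>
    have : Subsingleton (cutSpan K 0) := by
      rw [cutSpan_zero]; infer_instance
    exact HomologicalComplex.ExactAt.of_isZero
      (ModuleCat.isZero_of_subsingleton (ModuleCat.of K (cutSpan K 0)))
  | succ k =>
    rw [HomologicalComplex.exactAt_iff' _ (k + 2) (k + 1) k (by simp) (by simp),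
      ShortComplex.moduleCat_exact_iff]
    intro x hx
    change (cutComplex K).d (k + 1) k x = 0 at hx
    rw [cutComplex_d] at hx
    obtain ⟨y, hy, hyx⟩ := exists_boundary_eq (K := K) (x := x.1) x.2 (congrArg Subtype.val hx)
    refine ⟨⟨y, hy⟩, ?_⟩
    change (cutComplex K).d (k + 2) (k + 1) ⟨y, hy⟩ = x
    rw [cutComplex_d]
    exact Subtype.ext hyx

/-- The inclusion `𝒞 → 𝒢`. -/
def cutInclusion : cutComplex K ⟶ graphComplex K :=
  ChainComplex.ofHom
    (fun k => ModuleCat.ofHom (Submodule.inclusion (cutSpan_le_graphSpan (K := K) (k := k))))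
    (fun k => by
      rw [graphComplex_d, cutComplex_d]
      rfl)

/-- The short exact sequence `0 → 𝒞 → 𝒢 → 𝒢 / 𝒞 → 0`. -/
def cutShortComplex : ShortComplex (ChainComplex (ModuleCat.{u} K) ℕ) :=
  ShortComplex.mk (cutInclusion K) (quotientMap K) (by
    ext k x
    exact (Submodule.Quotient.mk_eq_zero _).2 x.2)

theorem cutShortComplex_shortExact : (cutShortComplex K).ShortExact := by
  refine HomologicalComplex.shortExact_of_degreewise_shortExact _ fun k => ?_
  refine ModuleCat.shortComplex_shortExact _ ?_ ?_ ?_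
  · intro x
    constructor
    · intro hx
      exact ⟨⟨x.1, (Submodule.Quotient.mk_eq_zero
        ((cutSpan K k).submoduleOf (graphSpan K k))).1 hx⟩, rfl⟩
    · rintro ⟨y, rfl⟩
      exact (Submodule.Quotient.mk_eq_zero _).2 y.2
  · exact Submodule.inclusion_injective cutSpan_le_graphSpan
  · exact Submodule.mkQ_surjective _

/-- In the long exact sequence of `0 → 𝒞 → 𝒢 → 𝒢 / 𝒞 → 0` the neighbours of the induced map are
homology groups of `𝒞`, which vanish. -/
theorem quasiIso_quotientMap : QuasiIso (quotientMap K) := by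
  have hS := cutShortComplex_shortExact K
  have hz : ∀ i, Limits.IsZero ((cutShortComplex K).X₁.homology i) := fun i =>
    (cutComplex_acyclic K i).isZero_homology
  rw [quasiIso_iff]
  intro i
  rw [quasiIsoAt_iff_isIso_homologyMap]
  have hmono : Mono (HomologicalComplex.homologyMap (cutShortComplex K).g i) :=
    (hS.homology_exact₂ i).mono_g ((hz i).eq_of_src _ _)
  have hepi : Epi (HomologicalComplex.homologyMap (cutShortComplex K).g i) := by
    -- In degree `0` there is no connecting map to a lower degree; surjectivity on homology comes
    -- directly from that of the quotient map.
    cases i with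
    | zero =>
      have := hS.epi_g
      exact HomologicalComplex.epi_homologyMap_of_epi_of_not_rel _ _ (by simp)
    | succ k =>
      exact (hS.homology_exact₃ (k + 1) k (by simp)).epi_f ((hz k).eq_of_tgt _ _)
  exact isIso_of_mono_of_epi (HomologicalComplex.homologyMap (cutShortComplex K).g i)

end Homology

end CommGraphComplex

end

theorem theorem1 {K : Type*} [Field K] [CharZero K] :
    (CommGraphComplex.cutComplex K).Acyclic ∧ QuasiIso (CommGraphComplex.quotientMap K) :=
  ⟨CommGraphComplex.cutComplex_acyclic K, CommGraphComplex.quasiIso_quotientMap K⟩
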